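/- **Setting.** Let $u:\mathbb R^5\to\mathbb R^5$ and $P:\mathbb R^5\to\mathbb R$. The pair $(u,P)$ is a *weak solution* of the stationary Navier–Stokes system $$\operatorname{div}u=0,\qquad (u\cdot\nabla)u+\nabla P=\Delta u\qquad\text{in }\mathbb R^5$$ if $u\in W^{1,2}_{loc}(\mathbb R^5;\mathbb R^5)$, $P\in L^1_{loc}(\mathbb R^5)$ and both equations hold in the sense of distributions. It is a *suitable weak solution* if, moreover, $\left(\frac{|u|^2}{2}+P\right)u\in L^1_{loc}$ and there is a (nonnegative, locally finite Borel) measure $\mu$ on $\mathbb R^5$ such that $$\Delta\frac{|u|^2}{2}-|\nabla u|^2-\operatorname{div}\Big\{\Big(\frac{|u|^2}{2}+P\Big)u\Big\}=\mu\qquad\text{in the sense of distributions.}$$ All gradients below are weak gradients, $|\nabla u|^2=\sum_{i,j}|\partial_iu_j|^2$, and $B_r=\{x\in\mathbb R^5:|x|\le r\}$. **Proposition.** Let $(u,P)$ be a suitable weak solution in $\mathbb R^5$, and for $r>0$ define $$D(r)=\int_{B_r}\Big\{\frac{15}{4r^3}|u|^2+\frac1{4r}|\nabla u|^2+\frac3{4r^3}\big|\nabla(|x|u)\big|^2+\frac{3(r^2-|x|^2)}{4r^3}|\nabla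 u|^2\Big\}\,dx,$$ $$A(r)=\frac1{r^3}\int_{B_r}(x\cdot\nabla)\frac{|u|^2}{2}\,dx+\frac9{4r^3}\int_{B_r}|u|^2\,dx-\frac1{r^2}\int_{B_r}\Big\{\frac{|u|^2}{2}+P\Big\}\,u\cdot\frac{x}{|x|}\,dx.$$ Then these functionals are well defined: $|u|^2/2$ has a locally integrable weak gradient, $|x|u\in W^{1,2}_{loc}(\mathbb R^5;\mathbb R^5)$, and for every $r>0$ all the integrals converge. Moreover $D(r)\ge0$ for every $r>0$. The function $A$ is absolutely continuous on every interval $[a,b]$ with $0<a\le b<\infty$, hence differentiable at almost every $r>0$, and at every $r>0$ at which $A$ is differentiable $$\frac{dA}{dr}(r)\ \ge\ \frac1r\,D(r)+\frac2{r^3}\int_{B_r}\Big\{\frac{|u|^2}{2}+P\Big\}\,u\cdot\frac{x}{|x|}\,dx .$$ -/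

import Mathlib

open MeasureTheory Set
open scoped ContDiff RealInnerProductSpace Laplacian

namespace StatNS

/-- Euclidean space of dimension `n`. -/
abbrev Euc (n : ℕ) : Type := EuclideanSpace ℝ (Fin n)

/-- The `i`-th vector of the standard basis. -/
noncomputable def basisVec {n : ℕ} (i : Fin n) : Euc n := EuclideanSpace.single i 1

/-- Smooth compactly supported functions on `ℝⁿ` with values in `F`. -/
def IsTest {n : ℕ} {F : Type*} [NormedAddCommGroup F] [NormedSpace ℝ F] (φ : Euc n → F) : Prop :=
  ContDiff ℝ ∞ φ ∧ HasCompactSupport φ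

/-- `G` is the distributional gradient of the locally integrable function `f`, and `G` is locally
integrable; `G x v` is the derivative of `f` at `x` in the direction `v`. -/
def IsWeakGrad {n : ℕ} {F : Type*} [NormedAddCommGroup F] [NormedSpace ℝ F]
    (f : Euc n → F) (G : Euc n → (Euc n →L[ℝ] F)) : Prop :=
  LocallyIntegrable f volume ∧ LocallyIntegrable G volume ∧
    ∀ φ : Euc n → ℝ, IsTest φ → ∀ v : Euc n,
      ∫ x, (fderiv ℝ φ x v) • f x = - ∫ x, φ x • G x v

open Classical in
/-- The weak gradient `∇f`, unique up to a null set when it exists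
(and `0` when there is none). -/
noncomputable def weakGrad {n : ℕ} {F : Type*} [NormedAddCommGroup F] [NormedSpace ℝ F]
    (f : Euc n → F) : Euc n → (Euc n →L[ℝ] F) :=
  if h : ∃ G, IsWeakGrad f G then h.choose else 0

/-- The local Sobolev space `W^{1,2}_loc(ℝⁿ; F)`. -/
def MemW12Loc {n : ℕ} {F : Type*} [NormedAddCommGroup F] [NormedSpace ℝ F]
    (f : Euc n → F) : Prop :=
  (∃ G, IsWeakGrad f G) ∧
    ∀ K : Set (Euc n), IsCompact K →
      MemLp f 2 (volume.restrict K) ∧ MemLp (weakGrad f) 2 (volume.restrict K)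

/-- The Frobenius inner product `L : M = ∑_{i,j} (∂_i L_j) (∂_i M_j)` of two Jacobians. -/
noncomputable def frobInner {n : ℕ} (L M : Euc n →L[ℝ] Euc n) : ℝ :=
  ∑ i : Fin n, ⟪L (basisVec i), M (basisVec i)⟫

/-- The square of the Frobenius norm; `frobSq (weakGrad u x)` is `|∇u(x)|² = ∑_{i,j} |∂_i u_j|²`. -/
noncomputable def frobSq {n : ℕ} (L : Euc n →L[ℝ] Euc n) : ℝ := frobInner L L

/-- The classical divergence of a smooth vector field. -/
noncomputable def divergence {n : ℕ} (ψ : Euc n → Euc n) (x : Euc n) : ℝ :=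
  ∑ i : Fin n, (fderiv ℝ ψ x (basisVec i)) i

/-- Weak solutions of `div u = 0`, `(u · ∇) u + ∇P = Δu` on `ℝⁿ`, with `u ∈ W^{1,2}_loc` and
`P ∈ L¹_loc`; both equations hold in the sense of distributions. -/
structure IsWeakSolution {n : ℕ} (u : Euc n → Euc n) (P : Euc n → ℝ) : Prop where
  sobolev : MemW12Loc u
  pressure : LocallyIntegrable P volume
  div_free : ∀ φ : Euc n → ℝ, IsTest φ → ∫ x, fderiv ℝ φ x (u x) = 0
  momentum : ∀ ψ : Euc n → Euc n, IsTest ψ →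
    ∫ x, (⟪weakGrad u x (u x), ψ x⟫ - P x * divergence ψ x
      + frobInner (weakGrad u x) (fderiv ℝ ψ x)) = 0

/-- Suitable weak solutions: weak solutions for which the distribution
`Δ(|u|²/2) - |∇u|² - div((|u|²/2 + P) u)` is a (nonnegative, locally finite) measure. The local
integrability of the flux `(|u|²/2 + P) u` is what gives its distributional divergence a
meaning. -/
structure IsSuitableWeakSolution {n : ℕ} (u : Euc n → Euc n) (P : Euc n → ℝ) : Prop extends
    IsWeakSolution u P where
  flux : LocallyIntegrable (fun x => (‖u x‖ ^ 2 / 2 + P x) • u x) volume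
  local_energy : ∃ μ : Measure (Euc n), IsFiniteMeasureOnCompacts μ ∧
    ∀ φ : Euc n → ℝ, IsTest φ →
      ∫ x, (‖u x‖ ^ 2 / 2 * (Δ φ) x - frobSq (weakGrad u x) * φ x
        + (‖u x‖ ^ 2 / 2 + P x) * fderiv ℝ φ x (u x)) = ∫ x, φ x ∂μ

/-- The closed ball `B_r` of radius `r` about the origin of `ℝ⁵`. -/
def B (r : ℝ) : Set (Euc 5) := Metric.closedBall 0 r

/-- The radial flux density `(|u|²/2 + P) u · x/|x|`. -/
noncomputable def radialFlux (u : Euc 5 → Euc 5) (P : Euc 5 → ℝ) (x : Euc 5) : ℝ :=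
  (‖u x‖ ^ 2 / 2 + P x) * (⟪u x, x⟫ / ‖x‖)

/-- The integrand of `D(r)`. -/
noncomputable def DDensity (u : Euc 5 → Euc 5) (r : ℝ) (x : Euc 5) : ℝ :=
  15 / (4 * r ^ 3) * ‖u x‖ ^ 2
    + 1 / (4 * r) * frobSq (weakGrad u x)
    + 3 / (4 * r ^ 3) * frobSq (weakGrad (fun y => ‖y‖ • u y) x)
    + 3 * (r ^ 2 - ‖x‖ ^ 2) / (4 * r ^ 3) * frobSq (weakGrad u x)

/-- The functional `D(r)`. -/
noncomputable def D (u : Euc 5 → Euc 5) (r : ℝ) : ℝ := ∫ x in B r, DDensity u r x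

/-- The functional `A(r)`. -/
noncomputable def A (u : Euc 5 → Euc 5) (P : Euc 5 → ℝ) (r : ℝ) : ℝ :=
  1 / r ^ 3 * (∫ x in B r, weakGrad (fun y => ‖u y‖ ^ 2 / 2) x x)
    + 9 / (4 * r ^ 3) * (∫ x in B r, ‖u x‖ ^ 2)
    - 1 / r ^ 2 * ∫ x in B r, radialFlux u P x

end StatNS

/-! Write `w = |u|²/2`, `g = x · ∇w` and let `Φ` be the radial flux density. In polar coordinates
the integral of a locally integrable `f` over `B_t` is the primitive of its spherical density `S_f`
(`setIntegral_closedBall_eq`), so `A` is a sum of smooth factors times absolutely continuous ones,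
with `A'` computable at almost every radius.

The surface terms in `A'` are eliminated by two identities, both obtained from radial test functions
`η(|x|)` with `η' = χ` supported in `(0, ∞)`. The local energy equality gives `S_g(t)/t - S_Φ(t) =
∫_{B_t} |∇u|² + μ(B_t)` (`IsSuitableWeakSolution.ae_energy_balance`), and the divergence theorem for
`w x` gives `t S_w(t) = 5 ∫_{B_t} w + ∫_{B_t} g` (`IsWeakGrad.ae_mul_sphericalDensity`).

On the other side, `|∇(|x|u)|² = |x|²|∇u|² + |u|² + 2g` almost everywhere, which reduces `D` to
integrals of `|u|²`, `|∇u|²` and `g` (`MemW12Loc.integrableOn_DDensity`). Comparing, `A'` equals the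
claimed lower bound plus `μ(B_t)/t² ≥ 0` for almost every `t`. The bound is continuous in `t` and
`A` is absolutely continuous, so the inequality extends to every point of differentiability
(`le_deriv_of_ae_le_deriv`). -/

namespace StatNS

/-! ### Weak gradients: uniqueness, product rule, localization. -/

section WeakGradient

variable {n : ℕ} {F : Type*} [NormedAddCommGroup F] [NormedSpace ℝ F]

theorem IsTest.continuous {φ : Euc n → F} (h : IsTest φ) : Continuous φ := h.1.continuous

theorem IsTest.differentiable {φ : Euc n → F} (h : IsTest φ) : Differentiable ℝ φ :=
  h.1.differentiable (by simp)

theorem IsTest.fderiv_apply {φ : Euc n → F} (h : IsTest φ) (v : Euc n) :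
    IsTest (fun x => fderiv ℝ φ x v) :=
  ⟨(h.1.fderiv_right (by simp)).clm_apply contDiff_const, h.2.fderiv_apply ℝ v⟩

theorem IsTest.smul_left {φ : Euc n → ℝ} (h : IsTest φ) {χ : Euc n → F} (hχ : ContDiff ℝ ∞ χ) :
    IsTest (fun x => φ x • χ x) :=
  ⟨h.1.smul hχ, h.2.smul_right⟩

theorem IsTest.integrable_smul {φ : Euc n → ℝ} (h : IsTest φ) {f : Euc n → F}
    (hf : LocallyIntegrable f volume) : Integrable (fun x => φ x • f x) :=
  hf.integrable_smul_left_of_hasCompactSupport h.continuous h.2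

theorem locallyIntegrable_fun_add {G : Type*} [NormedAddCommGroup G] {f g : Euc n → G}
    (hf : LocallyIntegrable f volume) (hg : LocallyIntegrable g volume) :
    LocallyIntegrable (fun x => f x + g x) volume :=
  locallyIntegrable_iff.2 fun K hK => by
    have h1 : Integrable f (volume.restrict K) := hf.integrableOn_isCompact hK
    have h2 : Integrable g (volume.restrict K) := hg.integrableOn_isCompact hK
    exact h1.add h2

/-- A measurable function dominated by a continuous multiple of a locally integrable function is
locally integrable. -/
theorem locallyIntegrable_of_norm_le_mul {G : Type*} [NormedAddCommGroup G]
    {f : Euc n → F} {g : Euc n → G} {c : Euc n → ℝ} (hf : LocallyIntegrable f volume)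
    (hg : AEStronglyMeasurable g volume) (hc : Continuous c)
    (h : ∀ x, ‖g x‖ ≤ c x * ‖f x‖) : LocallyIntegrable g volume := by
  have h1 : LocallyIntegrable (fun x => c x • f x) volume :=
    locallyIntegrableOn_univ.1 ((hf.locallyIntegrableOn univ).continuousOn_smul
      isOpen_univ.isLocallyClosed hc.continuousOn)
  refine h1.mono hg (Filter.Eventually.of_forall fun x => (h x).trans ?_)
  rw [norm_smul]
  gcongr
  exact Real.le_norm_self _

theorem locallyIntegrable_clm_apply {f : Euc n → (Euc n →L[ℝ] F)}
    (hf : LocallyIntegrable f volume) {c : Euc n → Euc n} (hc : Continuous c) :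
    LocallyIntegrable (fun x => f x (c x)) volume :=
  locallyIntegrable_of_norm_le_mul (c := fun x => ‖c x‖) hf
    ((ContinuousLinearMap.id ℝ (Euc n →L[ℝ] F)).aestronglyMeasurable_comp₂
      hf.aestronglyMeasurable hc.aestronglyMeasurable) hc.norm
    (fun x => by rw [mul_comm]; exact (f x).le_opNorm _)

/-- Each direction has its own exceptional null set; a linear map is determined by finitely many
basis vectors, so finitely many null sets suffice. -/
theorem IsWeakGrad.ae_eq [CompleteSpace F] {f : Euc n → F} {G G' : Euc n → (Euc n →L[ℝ] F)}
    (h : IsWeakGrad f G) (h' : IsWeakGrad f G') : G =ᵐ[volume] G' := by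
  have key : ∀ v : Euc n, ∀ᵐ x, G x v = G' x v := fun v => by
    refine ae_eq_of_integral_contDiff_smul_eq
      (locallyIntegrable_clm_apply h.2.1 continuous_const)
      (locallyIntegrable_clm_apply h'.2.1 continuous_const) fun φ hφ hφc => ?_
    have h1 := h.2.2 φ ⟨hφ, hφc⟩ v
    rw [h'.2.2 φ ⟨hφ, hφc⟩ v] at h1
    exact (neg_injective h1).symm
  have := ae_all_iff.2 fun i : Fin n => key (basisVec i)
  filter_upwards [this] with x hx
  have : (G x).toLinearMap = (G' x).toLinearMap :=
    (EuclideanSpace.basisFun (Fin n) ℝ).toBasis.ext fun i => by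
      simpa [basisVec] using hx i
  ext1 v
  exact congrArg (fun L => L v) this

theorem isWeakGrad_weakGrad {f : Euc n → F} (h : ∃ G, IsWeakGrad f G) :
    IsWeakGrad f (weakGrad f) := by
  rw [weakGrad, dif_pos h]
  exact h.choose_spec

theorem IsWeakGrad.weakGrad_ae_eq [CompleteSpace F] {f : Euc n → F}
    {G : Euc n → (Euc n →L[ℝ] F)} (h : IsWeakGrad f G) : weakGrad f =ᵐ[volume] G :=
  (isWeakGrad_weakGrad ⟨G, h⟩).ae_eq h

/-- Product rule for a smooth function and a weakly differentiable one. -/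
theorem IsWeakGrad.smul_contDiff {f : Euc n → F} {G : Euc n → (Euc n →L[ℝ] F)}
    (h : IsWeakGrad f G) {χ : Euc n → ℝ} (hχ : ContDiff ℝ ∞ χ) :
    IsWeakGrad (fun x => χ x • f x)
      (fun x => χ x • G x + (fderiv ℝ χ x).smulRight (f x)) := by
  obtain ⟨hf, hG, hfG⟩ := h
  have hdχ : Continuous (fun x => fderiv ℝ χ x) := hχ.continuous_fderiv (by simp)
  have hχf : LocallyIntegrable (fun x => χ x • f x) volume :=
    locallyIntegrable_of_norm_le_mul (c := fun x => ‖χ x‖) hf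
      (hχ.continuous.aestronglyMeasurable.smul hf.aestronglyMeasurable) hχ.continuous.norm
      fun x => (norm_smul _ _).le
  have hχG : LocallyIntegrable (fun x => χ x • G x) volume :=
    locallyIntegrable_of_norm_le_mul (c := fun x => ‖χ x‖) hG
      (hχ.continuous.aestronglyMeasurable.smul hG.aestronglyMeasurable) hχ.continuous.norm
      fun x => (norm_smul _ _).le
  have hdf : LocallyIntegrable (fun x => (fderiv ℝ χ x).smulRight (f x)) volume := by
    refine locallyIntegrable_of_norm_le_mul (c := fun x => ‖fderiv ℝ χ x‖) hf ?_ hdχ.norm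
      fun x => (ContinuousLinearMap.norm_smulRight_apply _ _).le
    exact (ContinuousLinearMap.smulRightL ℝ (Euc n) F).aestronglyMeasurable_comp₂
      hdχ.aestronglyMeasurable hf.aestronglyMeasurable
  have hsum : LocallyIntegrable
      (fun x => χ x • G x + (fderiv ℝ χ x).smulRight (f x)) volume :=
    locallyIntegrable_fun_add hχG hdf
  refine ⟨hχf, hsum, fun φ hφ v => ?_⟩
  -- `φ χ` is again a test function; testing `f` with it and expanding the derivative is the whole
  -- product rule.
  have hφχ : IsTest (fun x => φ x * χ x) := hφ.smul_left hχ
  have hd : ∀ x, fderiv ℝ (fun x => φ x * χ x) x v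
      = φ x * fderiv ℝ χ x v + fderiv ℝ φ x v * χ x := fun x => by
    rw [fderiv_fun_mul (hφ.differentiable x) (hχ.differentiable (by simp) x)]
    simp [mul_comm]
  have hdχv : Continuous (fun x => fderiv ℝ χ x v) := hdχ.clm_apply continuous_const
  have h1 := hfG _ hφχ v
  have i1 : Integrable (fun x => (φ x * fderiv ℝ χ x v) • f x) :=
    hf.integrable_smul_left_of_hasCompactSupport (hφ.continuous.mul hdχv) hφ.2.mul_right
  have i2 : Integrable (fun x => (fderiv ℝ φ x v * χ x) • f x) :=
    hf.integrable_smul_left_of_hasCompactSupport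
      ((hφ.fderiv_apply v).continuous.mul hχ.continuous) (hφ.fderiv_apply v).2.mul_right
  have i3 : Integrable (fun x => (φ x * χ x) • G x v) :=
    hφχ.integrable_smul (locallyIntegrable_clm_apply hG continuous_const)
  simp only [hd, add_smul] at h1
  rw [integral_add i1 i2] at h1
  have e1 : ∫ x, (fderiv ℝ φ x v) • χ x • f x = ∫ x, (fderiv ℝ φ x v * χ x) • f x := by
    simp only [mul_smul]
  have e2 : ∫ x, φ x • (χ x • G x + (fderiv ℝ χ x).smulRight (f x)) v
      = (∫ x, (φ x * χ x) • G x v) + ∫ x, (φ x * fderiv ℝ χ x v) • f x := by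
    rw [← integral_add i3 i1]
    simp [mul_smul]
  rw [e1, e2]
  rw [eq_comm, neg_add, ← h1]
  abel

/-- Multiplication by a continuous compactly supported function maps `L²_loc` to `L²`. -/
theorem memLp_smul_of_hasCompactSupport {f : Euc n → F}
    (hm : AEStronglyMeasurable f volume)
    (hf : ∀ K : Set (Euc n), IsCompact K → MemLp f 2 (volume.restrict K))
    {φ : Euc n → ℝ} (hφ : Continuous φ) (hc : HasCompactSupport φ) :
    MemLp (fun x => φ x • f x) 2 volume := by
  obtain ⟨C, hC⟩ := hφ.bounded_above_of_compact_support hc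
  have h1 : MemLp ((tsupport φ).indicator f) 2 volume :=
    (memLp_indicator_iff_restrict (isClosed_tsupport φ).measurableSet).2 (hf _ hc)
  refine h1.of_le_mul (c := C) (hφ.aestronglyMeasurable.smul hm)
    (Filter.Eventually.of_forall fun x => ?_)
  by_cases hx : x ∈ tsupport φ
  · rw [indicator_of_mem hx, norm_smul]
    gcongr
    exact hC x
  · simp [image_eq_zero_of_notMem_tsupport hx, indicator_of_notMem hx]

end WeakGradient

/-! ### Integration by parts for two Sobolev functions, through correlations. -/

section Correlation

variable {n : ℕ} {F : Type*} [NormedAddCommGroup F] [InnerProductSpace ℝ F]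

/-- The correlation of two `L²` functions is continuous. -/
theorem continuous_correlation {a b : Euc n → F}
    (ha : MemLp a 2 volume) (hb : MemLp b 2 volume) :
    Continuous (fun h : Euc n => ∫ x, ⟪a x, b (h + x)⟫) := by
  have : Fact ((2 : ENNReal) ≠ ⊤) := ⟨by simp⟩
  -- Translations act continuously on `L²`.
  have hc : Continuous (fun h : Euc n => (DomAddAct.mk h +ᵥ hb.toLp b : Lp F 2 volume)) :=
    (DomAddAct.continuous_mk).vadd continuous_const
  have hi := (continuous_const (y := ha.toLp a)).inner (𝕜 := ℝ) hc
  refine hi.congr fun h => ?_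
  rw [L2.inner_def, DomAddAct.mk_vadd_toLp]
  refine integral_congr_ae ?_
  filter_upwards [ha.coeFn_toLp, (hb.comp_measurePreserving
    (measurePreserving_vadd h (volume : Measure (Euc n)))).coeFn_toLp] with x h1 h2
  rw [h1]
  exact congrArg _ h2

theorem integrable_smul_inner_prod {a b : Euc n → F} (ha : Integrable a) (hb : Integrable b)
    {k : Euc n → ℝ} (hk : Continuous k) (hkc : HasCompactSupport k) :
    Integrable (fun z : Euc n × Euc n => k (z.2 - z.1) * ⟪a z.1, b z.2⟫)
      (volume.prod volume) := by
  obtain ⟨C, hC⟩ := hk.bounded_above_of_compact_support hkc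
  have h0 : Integrable (fun z : Euc n × Euc n => ⟪a z.1, b z.2⟫) (volume.prod volume) :=
    Integrable.op_fst_snd (op := fun x y : F => ⟪x, y⟫) continuous_inner
      ⟨1, fun x y => by rw [one_mul]; exact norm_inner_le_norm x y⟩ ha hb
  exact h0.bdd_mul (c := C) (by fun_prop) (Filter.Eventually.of_forall fun z => hC _)

/-- Testing a correlation against a continuous compactly supported function. -/
theorem integral_mul_correlation {a b : Euc n → F} (ha : Integrable a) (hb : Integrable b)
    {k : Euc n → ℝ} (hk : Continuous k) (hkc : HasCompactSupport k) :
    ∫ h, k h * ∫ x, ⟪a x, b (h + x)⟫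
      = ∫ z : Euc n × Euc n, k (z.2 - z.1) * ⟪a z.1, b z.2⟫ ∂(volume.prod volume) := by
  have hi := integrable_smul_inner_prod ha hb hk hkc
  have hmp : MeasurePreserving (fun z : Euc n × Euc n => (z.1, z.2 + z.1))
      (volume.prod volume) (volume.prod volume) := by
    simpa only [add_comm] using measurePreserving_prod_add (volume : Measure (Euc n)) volume
  have hi2 : Integrable (fun z : Euc n × Euc n => k z.2 * ⟪a z.1, b (z.2 + z.1)⟫)
      (volume.prod volume) := by
    simpa [Function.comp_def] using hmp.integrable_comp_of_integrable hi
  calc ∫ h, k h * ∫ x, ⟪a x, b (h + x)⟫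
      = ∫ h, ∫ x, k h * ⟪a x, b (h + x)⟫ := by simp only [integral_const_mul]
    _ = ∫ x, ∫ h, k h * ⟪a x, b (h + x)⟫ := (integral_integral_swap hi2).symm
    _ = ∫ x, ∫ y, k (y - x) * ⟪a x, b y⟫ := by
        congr 1
        ext x
        simpa using integral_add_right_eq_self (fun y => k (y - x) * ⟪a x, b y⟫) x
    _ = _ := (integral_prod _ hi).symm

/-- Integration by parts for compactly supported `L²` functions with `L²` weak gradients. -/
theorem IsWeakGrad.integral_inner_eq_neg [CompleteSpace F] {f g : Euc n → F}
    {Gf Gg : Euc n → (Euc n →L[ℝ] F)} (hf : IsWeakGrad f Gf) (hg : IsWeakGrad g Gg) (v : Euc n)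
    (if1 : Integrable f) (if2 : MemLp f 2 volume)
    (ig1 : Integrable g) (ig2 : MemLp g 2 volume)
    (iF1 : Integrable (fun x => Gf x v)) (iF2 : MemLp (fun x => Gf x v) 2 volume)
    (iG1 : Integrable (fun x => Gg x v)) (iG2 : MemLp (fun x => Gg x v) 2 volume) :
    ∫ x, ⟪Gf x v, g x⟫ = - ∫ x, ⟪f x, Gg x v⟫ := by
  have c1 := continuous_correlation iF2 ig2
  have c2 := (continuous_correlation if2 iG2).neg
  -- The identity is proved for all translates `g (h + ·)` at once: both sides are continuous in
  -- `h`, so equality as distributions in `h` gives equality at `h = 0`. This replaces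
  -- mollification.
  suffices h : (fun h : Euc n => ∫ x, ⟪Gf x v, g (h + x)⟫)
      = fun h : Euc n => - ∫ x, ⟪f x, Gg (h + x) v⟫ by
    simpa using congrFun h 0
  refine (c1.ae_eq_iff_eq volume c2).1 ?_
  refine ae_eq_of_integral_contDiff_smul_eq c1.locallyIntegrable c2.locallyIntegrable
    fun ρ hρ hρc => ?_
  have hρt : IsTest ρ := ⟨hρ, hρc⟩
  have hdρ := hρt.fderiv_apply v
  simp only [smul_eq_mul, Pi.neg_apply, mul_neg, integral_neg]
  rw [integral_mul_correlation iF1 ig1 hρt.continuous hρc,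
    integral_mul_correlation if1 iG1 hρt.continuous hρc,
    integral_prod_symm _ (integrable_smul_inner_prod iF1 ig1 hρt.continuous hρc),
    integral_prod _ (integrable_smul_inner_prod if1 iG1 hρt.continuous hρc)]
  -- With kernel `ρ (y - x)`, the derivative passes from `f` to the kernel in the variable `x`, then
  -- from the kernel to `g` in the variable `y`; the two differentiations of the kernel differ by a
  -- sign.
  trans ∫ z : Euc n × Euc n, fderiv ℝ ρ (z.2 - z.1) v * ⟪f z.1, g z.2⟫ ∂(volume.prod volume)
  · rw [integral_prod_symm _ (integrable_smul_inner_prod if1 ig1 hdρ.continuous hdρ.2)]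
    congr 1
    ext y
    have ht : IsTest (fun x => ρ (y - x)) :=
      ⟨hρ.comp (contDiff_const.sub contDiff_id), hρc.comp_homeomorph (Homeomorph.subLeft y)⟩
    have hd : ∀ x, fderiv ℝ (fun x => ρ (y - x)) x v = - fderiv ℝ ρ (y - x) v := fun x => by
      have h1 := ((hρt.differentiable (y - x)).hasFDerivAt).comp x
        ((hasFDerivAt_id x).const_sub y)
      have h2 := h1.fderiv
      simp only [Function.comp_def] at h2
      rw [h2]; simp
    have h1 := hf.2.2 _ ht v
    simp only [hd, neg_smul, integral_neg, neg_inj] at h1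
    have i1 := ht.integrable_smul (locallyIntegrable_clm_apply hf.2.1 (continuous_const (y := v)))
    have hd2 : IsTest (fun x => - fderiv ℝ ρ (y - x) v) := by
      simpa only [hd] using ht.fderiv_apply v
    have i2 : Integrable (fun x => fderiv ℝ ρ (y - x) v • f x) := by
      simpa using (hd2.integrable_smul hf.1).neg
    have e1 := integral_inner (𝕜 := ℝ) i1 (g y)
    have e2 := integral_inner (𝕜 := ℝ) i2 (g y)
    rw [← h1, ← e2] at e1
    simpa only [inner_smul_right, real_inner_comm] using e1
  · rw [integral_prod _ (integrable_smul_inner_prod if1 ig1 hdρ.continuous hdρ.2), ← integral_neg]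
    congr 1
    ext x
    have ht : IsTest (fun y => ρ (y - x)) :=
      ⟨hρ.comp (contDiff_id.sub contDiff_const), hρc.comp_homeomorph (Homeomorph.subRight x)⟩
    have hd : ∀ y, fderiv ℝ (fun y => ρ (y - x)) y v = fderiv ℝ ρ (y - x) v := fun y => by
      rw [fderiv_comp_sub]
    have h1 := hg.2.2 _ ht v
    have i2 := (ht.fderiv_apply v).integrable_smul hg.1
    simp only [hd] at h1 i2
    have i1 := ht.integrable_smul (locallyIntegrable_clm_apply hg.2.1 (continuous_const (y := v)))
    have e1 := integral_inner (𝕜 := ℝ) i1 (f x)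
    have e2 := integral_inner (𝕜 := ℝ) i2 (f x)
    rw [h1, inner_neg_right, ← e1] at e2
    simpa only [inner_smul_right] using e2

end Correlation

/-! ### Weak gradients of `|u|²/2` and `|x| u`. -/

section SobolevProducts

variable {n : ℕ} {F : Type*} [NormedAddCommGroup F] [InnerProductSpace ℝ F]

theorem memLp_two_fun_add {G : Type*} [NormedAddCommGroup G] {μ : Measure (Euc n)}
    {f g : Euc n → G} (hf : MemLp f 2 μ) (hg : MemLp g 2 μ) :
    MemLp (fun x => f x + g x) 2 μ :=
  hf.add hg

theorem MemW12Loc.isWeakGrad {u : Euc n → F} (h : MemW12Loc u) : IsWeakGrad u (weakGrad u) :=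
  isWeakGrad_weakGrad h.1

theorem exists_isTest_eq_one (R : ℝ) :
    ∃ χ : Euc n → ℝ, IsTest χ ∧ ∀ x ∈ Metric.ball (0 : Euc n) R, χ x = 1 := by
  -- `max R 1` keeps the inner radius positive when `R ≤ 0`.
  let f : ContDiffBump (0 : Euc n) := ⟨max R 1, max R 1 + 1, by positivity, by linarith⟩
  exact ⟨f, ⟨f.contDiff, f.hasCompactSupport⟩, fun x hx =>
    f.one_of_mem_closedBall (Metric.ball_subset_closedBall
      (Metric.ball_subset_ball (le_max_left _ _) hx))⟩

theorem memLp_clm_apply {G : Euc n → (Euc n →L[ℝ] F)} {s : Set (Euc n)}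
    (h : MemLp G 2 (volume.restrict s)) (v : Euc n) :
    MemLp (fun x => G x v) 2 (volume.restrict s) := by
  refine h.of_le_mul (c := ‖v‖) ?_ (Filter.Eventually.of_forall fun x => ?_)
  · exact (ContinuousLinearMap.id ℝ (Euc n →L[ℝ] F)).aestronglyMeasurable_comp₂
      h.1 aestronglyMeasurable_const
  · rw [mul_comm]; exact (G x).le_opNorm v

/-- `W^{1,2}_loc` functions multiplied by test functions: the integrability needed to integrate
by parts. -/
theorem MemW12Loc.smul_isTest {u : Euc n → F} (h : MemW12Loc u) {φ : Euc n → ℝ} (hφ : IsTest φ)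
    (v : Euc n) :
    let G := fun x => φ x • weakGrad u x + (fderiv ℝ φ x).smulRight (u x)
    IsWeakGrad (fun x => φ x • u x) G ∧ Integrable (fun x => φ x • u x) ∧
      MemLp (fun x => φ x • u x) 2 volume ∧ Integrable (fun x => G x v) ∧
      MemLp (fun x => G x v) 2 volume := by
  intro G
  have hw := h.isWeakGrad
  have hG := hw.smul_contDiff hφ.1
  have hu2 := fun K hK => (h.2 K hK).1
  have hg := locallyIntegrable_clm_apply hw.2.1 (continuous_const (y := v))
  have hd := hφ.fderiv_apply v
  refine ⟨hG, hφ.integrable_smul hw.1,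
    memLp_smul_of_hasCompactSupport hw.1.aestronglyMeasurable hu2 hφ.continuous hφ.2, ?_, ?_⟩
  · have := (hφ.integrable_smul hg).add (hd.integrable_smul hw.1)
    simpa [G, Pi.add_def] using this
  · have := (memLp_smul_of_hasCompactSupport hg.aestronglyMeasurable
      (fun K hK => memLp_clm_apply (h.2 K hK).2 v) hφ.continuous hφ.2).add
      (memLp_smul_of_hasCompactSupport hw.1.aestronglyMeasurable hu2 hd.continuous hd.2)
    simpa [G, Pi.add_def] using this

/-- The weak gradient of `|u|²/2` is `v ↦ ⟪u, ∂ᵥ u⟫`. -/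
theorem MemW12Loc.isWeakGrad_normSq_div_two [CompleteSpace F] {u : Euc n → F}
    (h : MemW12Loc u) :
    IsWeakGrad (fun x => ‖u x‖ ^ 2 / 2) (fun x => (innerSL ℝ (u x)).comp (weakGrad u x)) := by
  have hw := h.isWeakGrad
  have hl1 : LocallyIntegrable (fun x => ‖u x‖ ^ 2 / 2) volume :=
    locallyIntegrable_iff.2 fun K hK =>
      (((h.2 K hK).1.integrable_norm_pow (p := 2) (by simp)).div_const 2 :)
  have hl2 : LocallyIntegrable (fun x => (innerSL ℝ (u x)).comp (weakGrad u x)) volume := by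
    refine locallyIntegrable_iff.2 fun K hK => ?_
    have h1 := (h.2 K hK).1.norm.integrable_mul (h.2 K hK).2.norm
    refine Integrable.mono h1 ?_ (Filter.Eventually.of_forall fun x => ?_)
    · exact (ContinuousLinearMap.compL ℝ (Euc n) F ℝ).aestronglyMeasurable_comp₂
        ((innerSL ℝ).continuous.comp_aestronglyMeasurable (h.2 K hK).1.1) (h.2 K hK).2.1
    · refine (ContinuousLinearMap.opNorm_comp_le _ _).trans ?_
      simp
  refine ⟨hl1, hl2, fun φ hφ v => ?_⟩
  -- Integration by parts is applied to `φ u` and `χ u` with `χ = 1` on an open ball containing the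
  -- support of `φ`, so that `∇χ` vanishes there as well.
  obtain ⟨R, hR⟩ := hφ.2.isBounded.subset_ball (0 : Euc n)
  obtain ⟨χ, hχ, hχ1⟩ := exists_isTest_eq_one (n := n) R
  obtain ⟨a1, a2, a3, a4, a5⟩ := h.smul_isTest hφ v
  obtain ⟨b1, b2, b3, b4, b5⟩ := h.smul_isTest hχ v
  have key := a1.integral_inner_eq_neg b1 v a2 a3 b2 b3 a4 a5 b4 b5
  have hdχ : ∀ x ∈ tsupport φ, χ x = 1 ∧ fderiv ℝ χ x = 0 := fun x hx => by
    refine ⟨hχ1 x (hR hx), ?_⟩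
    have : χ =ᶠ[nhds x] fun _ => 1 :=
      Filter.eventually_of_mem (Metric.isOpen_ball.mem_nhds (hR hx)) hχ1
    rw [this.fderiv_eq]; simp
  have e1 : ∀ x, ⟪(φ x • weakGrad u x + (fderiv ℝ φ x).smulRight (u x)) v, χ x • u x⟫
      = φ x * ⟪u x, weakGrad u x v⟫ + 2 * (fderiv ℝ φ x v * (‖u x‖ ^ 2 / 2)) := fun x => by
    by_cases hx : x ∈ tsupport φ
    · simp [(hdχ x hx).1, inner_add_left, inner_smul_left, real_inner_comm]
      ring
    · have hφ0 := image_eq_zero_of_notMem_tsupport hx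
      have hφ1 : fderiv ℝ φ x = 0 :=
        image_eq_zero_of_notMem_tsupport fun h => hx (tsupport_fderiv_subset ℝ h)
      simp [hφ0, hφ1]
  have e2 : ∀ x, ⟪φ x • u x, (χ x • weakGrad u x + (fderiv ℝ χ x).smulRight (u x)) v⟫
      = φ x * ⟪u x, weakGrad u x v⟫ := fun x => by
    by_cases hx : x ∈ tsupport φ
    · simp [(hdχ x hx).1, (hdχ x hx).2, inner_smul_left]
    · simp [image_eq_zero_of_notMem_tsupport hx]
  -- `key` becomes `∫ (φ ⟪u, ∂ᵥu⟫ + 2 ∂ᵥφ |u|²/2) = -∫ φ ⟪u, ∂ᵥu⟫`, twice the desired identity.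
  simp only [e1, e2] at key
  have i1 : Integrable (fun x => φ x * ⟪u x, weakGrad u x v⟫) :=
    hφ.integrable_smul (locallyIntegrable_clm_apply hl2 (continuous_const (y := v)))
  have i2 : Integrable (fun x => fderiv ℝ φ x v * (‖u x‖ ^ 2 / 2)) :=
    (hφ.fderiv_apply v).integrable_smul hl1
  rw [integral_add i1 (i2.const_mul 2), integral_const_mul] at key
  simp only [smul_eq_mul, ContinuousLinearMap.comp_apply, innerSL_apply_apply]
  linarith

/-- These smooth functions replace `|x|`, whose kink at the origin rules out the smooth product
rule. -/
theorem contDiff_sqrt_normSq_add {ε : ℝ} (hε : 0 < ε) :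
    ContDiff ℝ ∞ (fun x : Euc n => √(‖x‖ ^ 2 + ε ^ 2)) :=
  ((contDiff_norm_sq ℝ).add contDiff_const).sqrt fun x => by positivity

theorem fderiv_sqrt_normSq_add {ε : ℝ} (hε : 0 < ε) (x v : Euc n) :
    fderiv ℝ (fun x : Euc n => √(‖x‖ ^ 2 + ε ^ 2)) x v = ⟪x, v⟫ / √(‖x‖ ^ 2 + ε ^ 2) := by
  have h1 := ((hasStrictFDerivAt_norm_sq x).hasFDerivAt.add_const (ε ^ 2)).sqrt
    (by positivity : ‖x‖ ^ 2 + ε ^ 2 ≠ 0)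
  rw [h1.fderiv]
  simp
  field_simp

/-- The weak gradient of `|x| u`. -/
theorem IsWeakGrad.norm_smul {u : Euc n → F} {G : Euc n → (Euc n →L[ℝ] F)}
    (h : IsWeakGrad u G) :
    IsWeakGrad (fun x => ‖x‖ • u x)
      (fun x => ‖x‖ • G x + (‖x‖⁻¹ • innerSL ℝ x).smulRight (u x)) := by
  have hl1 : LocallyIntegrable (fun x => ‖x‖ • u x) volume :=
    locallyIntegrable_of_norm_le_mul (c := fun x => ‖x‖) h.1
      (continuous_norm.aestronglyMeasurable.smul h.1.aestronglyMeasurable) continuous_norm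
      fun x => by simp [_root_.norm_smul]
  have hl2 : LocallyIntegrable (fun x => ‖x‖ • G x) volume :=
    locallyIntegrable_of_norm_le_mul (c := fun x => ‖x‖) h.2.1
      (continuous_norm.aestronglyMeasurable.smul h.2.1.aestronglyMeasurable) continuous_norm
      fun x => by simp [_root_.norm_smul]
  have hl3 : LocallyIntegrable
      (fun x : Euc n => (‖x‖⁻¹ • innerSL ℝ x).smulRight (u x)) volume := by
    refine locallyIntegrable_of_norm_le_mul (c := fun _ => 1) h.1 ?_ continuous_const
      fun x => ?_
    · refine (ContinuousLinearMap.smulRightL ℝ (Euc n) F).aestronglyMeasurable_comp₂ ?_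
        h.1.aestronglyMeasurable
      exact (measurable_norm.inv.aestronglyMeasurable).smul
        (innerSL ℝ).continuous.aestronglyMeasurable
    · rw [ContinuousLinearMap.norm_smulRight_apply, _root_.norm_smul, innerSL_apply_norm]
      gcongr
      simpa using inv_mul_le_one
  refine ⟨hl1, locallyIntegrable_fun_add hl2 hl3, fun φ hφ v => ?_⟩
  -- The product rule holds for `√(|x|² + ε²)`. As `ε → 0` dominated convergence applies: with `ε ≤
  -- 1` the factor is at most `|x| + 1`, and its derivative along `v` is at most `|v|`.
  let ε : ℕ → ℝ := fun k => 1 / ((k : ℝ) + 1)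
  have hε : ∀ k, 0 < ε k := fun k => by positivity
  have hε1 : ∀ k, ε k ≤ 1 := fun k => by
    simp only [ε]; rw [div_le_one (by positivity)]; linarith [(Nat.cast_nonneg k : (0:ℝ) ≤ k)]
  have hε0 : Filter.Tendsto ε Filter.atTop (nhds 0) := tendsto_one_div_add_atTop_nhds_zero_nat
  have hs : ∀ x : Euc n, Filter.Tendsto (fun k => √(‖x‖ ^ 2 + ε k ^ 2)) Filter.atTop
      (nhds ‖x‖) := fun x => by
    have h1 : Filter.Tendsto (fun k => √(‖x‖ ^ 2 + ε k ^ 2)) Filter.atTop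
      (nhds (√(‖x‖ ^ 2 + 0 ^ 2))) := ((hε0.pow 2).const_add _).sqrt
    simpa using h1
  have hsle : ∀ (x : Euc n) k, √(‖x‖ ^ 2 + ε k ^ 2) ≤ ‖x‖ + 1 := fun x k => by
    rw [Real.sqrt_le_left (by positivity)]
    nlinarith [norm_nonneg x, hε k, hε1 k]
  have hles : ∀ (x : Euc n) k, ‖x‖ ≤ √(‖x‖ ^ 2 + ε k ^ 2) := fun x k =>
    Real.le_sqrt_of_sq_le (by nlinarith [sq_nonneg (ε k)])
  have hq : ∀ x : Euc n, Filter.Tendsto (fun k => ⟪x, v⟫ / √(‖x‖ ^ 2 + ε k ^ 2)) Filter.atTop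
      (nhds (⟪x, v⟫ / ‖x‖)) := fun x => by
    -- At the origin the quotients vanish for every `k`, in agreement with the convention `0 / 0 =
    -- 0`.
    by_cases hx : x = 0
    · simp [hx]
    · exact tendsto_const_nhds.div (hs x) (norm_ne_zero_iff.2 hx)
  have hqle : ∀ (x : Euc n) k, |⟪x, v⟫ / √(‖x‖ ^ 2 + ε k ^ 2)| ≤ ‖v‖ := fun x k => by
    have h0 : 0 < √(‖x‖ ^ 2 + ε k ^ 2) := Real.sqrt_pos.2 (by have := hε k; positivity)
    rw [abs_div, abs_of_pos h0, div_le_iff₀ h0, mul_comm]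
    exact (abs_real_inner_le_norm x v).trans (by gcongr; exact hles x k)
  have hk : ∀ k, ∫ x, (fderiv ℝ φ x v) • √(‖x‖ ^ 2 + ε k ^ 2) • u x
      = - ∫ x, φ x • (√(‖x‖ ^ 2 + ε k ^ 2) • G x v + (⟪x, v⟫ / √(‖x‖ ^ 2 + ε k ^ 2)) • u x) :=
    fun k => by
      have := (h.smul_contDiff (contDiff_sqrt_normSq_add (n := n) (hε k))).2.2 φ hφ v
      simpa [fderiv_sqrt_normSq_add (hε k)] using this
  have hGv := locallyIntegrable_clm_apply h.2.1 (continuous_const (y := v))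
  have hdφ := hφ.fderiv_apply v
  have t1 : Filter.Tendsto (fun k => ∫ x, (fderiv ℝ φ x v) • √(‖x‖ ^ 2 + ε k ^ 2) • u x)
      Filter.atTop (nhds (∫ x, (fderiv ℝ φ x v) • ‖x‖ • u x)) := by
    refine tendsto_integral_of_dominated_convergence
      (fun x => ‖(fderiv ℝ φ x v * (‖x‖ + 1)) • u x‖) (fun k => ?_) ?_ (fun k => ?_) ?_
    · exact hdφ.continuous.aestronglyMeasurable.smul
        ((contDiff_sqrt_normSq_add (hε k)).continuous.aestronglyMeasurable.smul
          h.1.aestronglyMeasurable)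
    · exact (h.1.integrable_smul_left_of_hasCompactSupport
        (hdφ.continuous.mul (continuous_norm.add continuous_const)) hdφ.2.mul_right).norm
    · refine Filter.Eventually.of_forall fun x => ?_
      rw [mul_smul, _root_.norm_smul, _root_.norm_smul, _root_.norm_smul, _root_.norm_smul,
        Real.norm_of_nonneg (Real.sqrt_nonneg _),
        Real.norm_of_nonneg (by positivity : 0 ≤ ‖x‖ + 1)]
      gcongr
      exact hsle x k
    · exact Filter.Eventually.of_forall fun x => ((hs x).smul_const _).const_smul _
  have t2 : Filter.Tendsto (fun k => ∫ x, φ x • (√(‖x‖ ^ 2 + ε k ^ 2) • G x v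
      + (⟪x, v⟫ / √(‖x‖ ^ 2 + ε k ^ 2)) • u x))
      Filter.atTop (nhds (∫ x, φ x • (‖x‖ • G x v + (⟪x, v⟫ / ‖x‖) • u x))) := by
    refine tendsto_integral_of_dominated_convergence
      (fun x => ‖(φ x * (‖x‖ + 1)) • G x v‖ + ‖(φ x * ‖v‖) • u x‖) (fun k => ?_) ?_
      (fun k => ?_) ?_
    · have hc := (contDiff_sqrt_normSq_add (n := n) (hε k)).continuous
      refine hφ.continuous.aestronglyMeasurable.smul
        ((hc.aestronglyMeasurable.smul hGv.aestronglyMeasurable).add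
          (AEStronglyMeasurable.smul ?_ h.1.aestronglyMeasurable))
      exact (Measurable.div (by fun_prop) hc.measurable).aestronglyMeasurable
    · exact (hGv.integrable_smul_left_of_hasCompactSupport
        (hφ.continuous.mul (continuous_norm.add continuous_const)) hφ.2.mul_right).norm.add
        (h.1.integrable_smul_left_of_hasCompactSupport
        (hφ.continuous.mul continuous_const) hφ.2.mul_right).norm
    · refine Filter.Eventually.of_forall fun x => ?_
      rw [smul_add]
      refine (norm_add_le _ _).trans (add_le_add ?_ ?_)
      · rw [mul_smul, _root_.norm_smul, _root_.norm_smul, _root_.norm_smul, _root_.norm_smul,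
          Real.norm_of_nonneg (Real.sqrt_nonneg _),
          Real.norm_of_nonneg (by positivity : 0 ≤ ‖x‖ + 1)]
        gcongr
        exact hsle x k
      · rw [mul_smul, _root_.norm_smul, _root_.norm_smul, _root_.norm_smul, _root_.norm_smul,
          Real.norm_eq_abs (_ / _), norm_norm]
        gcongr
        exact hqle x k
    · exact Filter.Eventually.of_forall fun x =>
        (((hs x).smul_const _).add ((hq x).smul_const _)).const_smul _
  have := tendsto_nhds_unique t1 (by simpa only [hk] using t2.neg)
  rw [this]
  simp [div_eq_inv_mul]

/-- `|x| u` is in `W^{1,2}_loc` if `u` is. -/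
theorem MemW12Loc.norm_smul [CompleteSpace F] {u : Euc n → F} (h : MemW12Loc u) :
    MemW12Loc (fun x => ‖x‖ • u x) := by
  have hw := h.isWeakGrad.norm_smul
  refine ⟨⟨_, hw⟩, fun K hK => ?_⟩
  obtain ⟨C, hC⟩ := hK.exists_bound_of_continuousOn (f := fun x : Euc n => ‖x‖)
    continuous_norm.continuousOn
  have hbd : ∀ᵐ x ∂(volume.restrict K), ‖x‖ ≤ C := by
    filter_upwards [ae_restrict_mem hK.measurableSet] with x hx
    simpa using hC x hx
  obtain ⟨h1, h2⟩ := h.2 K hK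
  have m1 : MemLp (fun x => ‖x‖ • weakGrad u x) 2 (volume.restrict K) := by
    refine h2.of_le_mul (c := C) (continuous_norm.aestronglyMeasurable.smul h2.1) ?_
    filter_upwards [hbd] with x hx
    rw [_root_.norm_smul, norm_norm]
    gcongr
  have m2 : MemLp (fun x => (‖x‖⁻¹ • innerSL ℝ x).smulRight (u x)) 2 (volume.restrict K) := by
    refine h1.of_le_mul (c := 1) ?_ (Filter.Eventually.of_forall fun x => ?_)
    · refine (ContinuousLinearMap.smulRightL ℝ (Euc n) F).aestronglyMeasurable_comp₂ ?_ h1.1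
      exact (measurable_norm.inv.aestronglyMeasurable).smul
        (innerSL ℝ).continuous.aestronglyMeasurable
    · rw [ContinuousLinearMap.norm_smulRight_apply, _root_.norm_smul, innerSL_apply_norm]
      gcongr
      simpa using inv_mul_le_one
  have hae := ae_restrict_of_ae (s := K) hw.weakGrad_ae_eq
  refine ⟨h1.of_le_mul (c := C) (continuous_norm.aestronglyMeasurable.smul h1.1) ?_,
    (memLp_congr_ae hae).2 ?_⟩
  · filter_upwards [hbd] with x hx
    rw [_root_.norm_smul, norm_norm]
    gcongr
  · exact memLp_two_fun_add m1 m2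

end SobolevProducts

/-- Pointwise expansion of `|∇(|x| u)|²`. -/
theorem MemW12Loc.frobSq_weakGrad_norm_smul {n : ℕ} [NeZero n] {u : Euc n → Euc n}
    (h : MemW12Loc u) :
    ∀ᵐ x, frobSq (weakGrad (fun y => ‖y‖ • u y) x)
      = ‖x‖ ^ 2 * frobSq (weakGrad u x) + ‖u x‖ ^ 2
        + 2 * weakGrad (fun y => ‖u y‖ ^ 2 / 2) x x := by
  -- The origin is discarded: there `‖x‖⁻¹ = 0` would lose the term `|u|²`.
  have hne := measure_singleton (μ := (volume : Measure (Euc n))) 0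
  filter_upwards [h.isWeakGrad.norm_smul.weakGrad_ae_eq,
    h.isWeakGrad_normSq_div_two.weakGrad_ae_eq, compl_mem_ae_iff.2 hne] with x h1 h2 hx
  have hx0 : ‖x‖ ≠ 0 := norm_ne_zero_iff.2 hx
  have hxs : x = ∑ i, x i • basisVec i := by
    simpa [basisVec] using ((EuclideanSpace.basisFun (Fin n) ℝ).sum_repr x).symm
  have hnorm : ∑ i, x i ^ 2 = ‖x‖ ^ 2 := by
    simp [EuclideanSpace.norm_sq_eq]
  have hsum : ∑ i, x i * ⟪u x, weakGrad u x (basisVec i)⟫ = ⟪u x, weakGrad u x x⟫ := by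
    conv_rhs => rw [hxs, map_sum, inner_sum]
    simp [inner_smul_right, ← hxs]
  have hi : ∀ i, ⟪x, basisVec i⟫ = x i := fun i => by
    simp [basisVec, EuclideanSpace.inner_single_right]
  rw [h1, h2]
  simp only [frobSq, frobInner, add_apply, smul_apply,
    ContinuousLinearMap.smulRight_apply, innerSL_apply_apply, ContinuousLinearMap.comp_apply, hi,
    smul_eq_mul]
  rw [← hsum, Finset.mul_sum, Finset.mul_sum]
  have ht : ∀ i, ⟪‖x‖ • weakGrad u x (basisVec i) + (‖x‖⁻¹ * x i) • u x,
      ‖x‖ • weakGrad u x (basisVec i) + (‖x‖⁻¹ * x i) • u x⟫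
      = ‖x‖ ^ 2 * ⟪weakGrad u x (basisVec i), weakGrad u x (basisVec i)⟫
        + x i ^ 2 * (‖u x‖ ^ 2 / ‖x‖ ^ 2)
        + 2 * (x i * ⟪u x, weakGrad u x (basisVec i)⟫) := fun i => by
    rw [inner_add_left, inner_add_right, inner_add_right]
    simp only [inner_smul_left, inner_smul_right, real_inner_self_eq_norm_sq,
      real_inner_comm (u x), RCLike.conj_to_real]
    field_simp
    ring
  simp only [ht, Finset.sum_add_distrib]
  rw [← Finset.sum_mul, hnorm, mul_div_cancel₀]
  positivity

/-! ### Polar coordinates and ball integrals as one-variable primitives. -/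

section Radial

variable {n : ℕ}

/-- The density, with respect to Lebesgue measure on the half line, of the push-forward of
`f dx` under the norm. -/
noncomputable def sphericalDensity (f : Euc n → ℝ) : ℝ → ℝ :=
  (Ioi (0 : ℝ)).indicator fun s =>
    s ^ (n - 1) * ∫ θ, f (s • (θ : Euc n)) ∂(volume : Measure (Euc n)).toSphere

theorem sphericalDensity_of_nonpos (f : Euc n → ℝ) {s : ℝ} (hs : s ≤ 0) :
    sphericalDensity f s = 0 :=
  indicator_of_notMem (by simpa using hs) _

theorem sphericalDensity_radial_mul (k : ℝ → ℝ) (f : Euc n → ℝ) (s : ℝ) :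
    sphericalDensity (fun x => k ‖x‖ * f x) s = k s * sphericalDensity f s := by
  by_cases hs : 0 < s
  · have h : ∀ θ : Metric.sphere (0 : Euc n) 1, ‖s • (θ : Euc n)‖ = s := fun θ => by
      rw [norm_smul, norm_eq_of_mem_sphere, Real.norm_of_nonneg hs.le, mul_one]
    simp only [sphericalDensity, indicator_of_mem (mem_Ioi.2 hs), h, integral_const_mul]
    ring
  · simp [sphericalDensity_of_nonpos _ (not_lt.1 hs)]

/-- The origin is null, and its complement is identified with sphere times half line by a
measure-preserving homeomorphism. -/
theorem integrable_polar [NeZero n] {f : Euc n → ℝ} (hf : Integrable f) :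
    Integrable (fun p : Metric.sphere (0 : Euc n) 1 × Ioi (0 : ℝ) => f (p.2.1 • p.1.1))
      ((volume : Measure (Euc n)).toSphere.prod (.volumeIoiPow (n - 1))) := by
  have h1 := (volume : Measure (Euc n)).measurePreserving_homeomorphUnitSphereProd
  rw [finrank_euclideanSpace_fin] at h1
  have h2 := h1.integrable_comp_emb
    (g := fun p : Metric.sphere (0 : Euc n) 1 × Ioi (0 : ℝ) => f (p.2.1 • p.1.1))
    (Homeomorph.measurableEmbedding _)
  refine h2.1 ?_
  have h3 : Integrable (fun x : ({0}ᶜ : Set (Euc n)) => f x.1)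
      (volume.comap Subtype.val) :=
    (integrableOn_iff_comap_subtypeVal (measurableSet_singleton _).compl).1 hf.integrableOn
  refine h3.congr (Filter.Eventually.of_forall fun x => ?_)
  have hx : ‖(x : Euc n)‖ ≠ 0 := norm_ne_zero_iff.2 x.2
  simp [smul_smul, hx]

theorem integral_polar [NeZero n] (f : Euc n → ℝ) :
    ∫ x, f x = ∫ p : Metric.sphere (0 : Euc n) 1 × Ioi (0 : ℝ), f (p.2.1 • p.1.1)
      ∂((volume : Measure (Euc n)).toSphere.prod (.volumeIoiPow (n - 1))) := by
  have h1 := (volume : Measure (Euc n)).measurePreserving_homeomorphUnitSphereProd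
  rw [finrank_euclideanSpace_fin] at h1
  rw [← h1.integral_comp (Homeomorph.measurableEmbedding _)]
  have h2 := integral_subtype_comap (μ := (volume : Measure (Euc n)))
    (measurableSet_singleton (0 : Euc n)).compl f
  rw [MeasureTheory.restrict_compl_singleton] at h2
  rw [← h2]
  refine integral_congr_ae (Filter.Eventually.of_forall fun x => ?_)
  have hx : ‖(x : Euc n)‖ ≠ 0 := norm_ne_zero_iff.2 x.2
  simp [smul_smul, hx]

theorem Integrable.sphericalDensity [NeZero n] {f : Euc n → ℝ} (hf : Integrable f) :
    Integrable (sphericalDensity f) := by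
  have h := (integrable_polar hf).integral_prod_right
  rw [Measure.volumeIoiPow, integrable_withDensity_iff_integrable_smul' (by fun_prop) (by simp)]
    at h
  unfold StatNS.sphericalDensity
  rw [integrable_indicator_iff measurableSet_Ioi,
    integrableOn_iff_comap_subtypeVal measurableSet_Ioi]
  refine h.congr (Filter.Eventually.of_forall fun s => ?_)
  have hs : 0 ≤ s.1 ^ (n - 1) := pow_nonneg (le_of_lt s.2) _
  simp [ENNReal.toReal_ofReal hs]

/-- Fubini in polar coordinates; the Jacobian `s ^ (n - 1)` sits in the measure on one side and in
the density on the other. -/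
theorem integral_sphericalDensity [NeZero n] {f : Euc n → ℝ} (hf : Integrable f) :
    ∫ s, sphericalDensity f s = ∫ x, f x := by
  rw [integral_polar f, integral_prod_symm _ (integrable_polar hf)]
  simp only [Measure.volumeIoiPow, ENNReal.ofReal]
  rw [integral_withDensity_eq_integral_smul (by fun_prop),
    integral_subtype_comap measurableSet_Ioi fun a : ℝ => Real.toNNReal (a ^ (n - 1)) •
      ∫ θ, f (a • (θ : Euc n)) ∂(volume : Measure (Euc n)).toSphere]
  unfold sphericalDensity
  rw [integral_indicator measurableSet_Ioi]
  refine setIntegral_congr_fun measurableSet_Ioi fun s hs => ?_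
  have hs : 0 ≤ s ^ (n - 1) := pow_nonneg (le_of_lt hs) _
  simp [NNReal.smul_def, Real.coe_toNNReal _ hs]

theorem integral_radial_mul [NeZero n] {k : ℝ → ℝ} {f : Euc n → ℝ}
    (h : Integrable (fun x => k ‖x‖ * f x)) :
    ∫ x, k ‖x‖ * f x = ∫ s, k s * sphericalDensity f s := by
  rw [← integral_sphericalDensity h]
  simp only [sphericalDensity_radial_mul]

theorem indicator_closedBall_eq (f : Euc n → ℝ) (r : ℝ) :
    (Metric.closedBall (0 : Euc n) r).indicator f
      = fun x => (Iic r).indicator (fun _ => (1 : ℝ)) ‖x‖ * f x := by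
  ext x
  by_cases hx : ‖x‖ ≤ r <;> simp [indicator, hx]

theorem integrable_indicator_closedBall {f : Euc n → ℝ} (hf : LocallyIntegrable f volume) (r : ℝ) :
    Integrable (fun x => (Iic r).indicator (fun _ => (1 : ℝ)) ‖x‖ * f x) := by
  rw [← indicator_closedBall_eq]
  exact (hf.integrableOn_isCompact (isCompact_closedBall 0 r)).integrable_indicator
    Metric.isClosed_closedBall.measurableSet

/-- Truncating `f` to a ball of radius `r` makes it integrable and leaves its density unchanged up
to `r`. -/
theorem locallyIntegrable_sphericalDensity [NeZero n] {f : Euc n → ℝ}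
    (hf : LocallyIntegrable f volume) : LocallyIntegrable (sphericalDensity f) volume := by
  refine locallyIntegrable_iff.2 fun K hK => ?_
  obtain ⟨r, hr⟩ := hK.bddAbove
  have h := Integrable.sphericalDensity (integrable_indicator_closedBall hf r)
  refine (h.integrableOn (s := K)).congr_fun (fun s hs => ?_) hK.measurableSet
  rw [sphericalDensity_radial_mul, indicator_of_mem (mem_Iic.2 (hr hs)), one_mul]

theorem intervalIntegrable_sphericalDensity [NeZero n] {f : Euc n → ℝ}
    (hf : LocallyIntegrable f volume) (a b : ℝ) :
    IntervalIntegrable (sphericalDensity f) volume a b :=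
  ((locallyIntegrable_sphericalDensity hf).integrableOn_isCompact
    isCompact_uIcc).intervalIntegrable

/-- Continuity, absolute continuity and almost everywhere differentiability in the radius all follow
from this form. -/
theorem setIntegral_closedBall_eq [NeZero n] {f : Euc n → ℝ} (hf : LocallyIntegrable f volume)
    (r : ℝ) : ∫ x in Metric.closedBall (0 : Euc n) r, f x
      = ∫ s in (0 : ℝ)..r, sphericalDensity f s := by
  rw [← integral_indicator Metric.isClosed_closedBall.measurableSet, indicator_closedBall_eq,
    integral_radial_mul (integrable_indicator_closedBall hf r)]
  have h0 : ∀ s, (Iic r).indicator (fun _ => (1 : ℝ)) s * sphericalDensity f s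
      = (Ioc 0 r).indicator (sphericalDensity f) s := fun s => by
    by_cases hs : 0 < s
    · by_cases hr : s ≤ r <;> simp [indicator, hs, hr]
    · simp [sphericalDensity_of_nonpos f (not_lt.1 hs), indicator, hs]
  simp only [h0]
  rw [integral_indicator measurableSet_Ioc]
  -- For `r < 0` the ball is empty and the density vanishes on the nonpositive half line, so both
  -- sides are `0`.
  rcases le_or_gt 0 r with hr | hr
  · rw [intervalIntegral.integral_of_le hr]
  · rw [Ioc_eq_empty (by linarith), intervalIntegral.integral_of_ge hr.le,
      setIntegral_congr_fun (g := fun _ => (0 : ℝ)) measurableSet_Ioc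
        fun s hs => sphericalDensity_of_nonpos f hs.2]
    simp

theorem continuous_setIntegral_closedBall [NeZero n] {f : Euc n → ℝ}
    (hf : LocallyIntegrable f volume) :
    Continuous (fun r => ∫ x in Metric.closedBall (0 : Euc n) r, f x) := by
  simp only [setIntegral_closedBall_eq hf]
  exact intervalIntegral.continuous_primitive
    (fun a b => intervalIntegrable_sphericalDensity hf a b) 0

theorem absolutelyContinuousOnInterval_setIntegral_closedBall [NeZero n] {f : Euc n → ℝ}
    (hf : LocallyIntegrable f volume) {a b : ℝ} (ha : 0 ≤ a) (hab : a ≤ b) :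
    AbsolutelyContinuousOnInterval (fun r => ∫ x in Metric.closedBall (0 : Euc n) r, f x) a b := by
  simp only [setIntegral_closedBall_eq hf]
  have h : AbsolutelyContinuousOnInterval
      (fun r => ∫ s in (0 : ℝ)..r, sphericalDensity f s) 0 b :=
    (intervalIntegrable_sphericalDensity hf 0 b).absolutelyContinuousOnInterval_intervalIntegral (by simp)
  exact h.mono (by rw [uIcc_of_le hab, uIcc_of_le (ha.trans hab)]; exact Icc_subset_Icc_left ha)

theorem ae_hasDerivAt_setIntegral_closedBall [NeZero n] {f : Euc n → ℝ}
    (hf : LocallyIntegrable f volume) :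
    ∀ᵐ r, HasDerivAt (fun r => ∫ x in Metric.closedBall (0 : Euc n) r, f x)
      (sphericalDensity f r) r := by
  simp only [setIntegral_closedBall_eq hf]
  filter_upwards [LocallyIntegrable.ae_hasDerivAt_integral
    (locallyIntegrable_sphericalDensity hf)] with r hr
  exact hr 0

/-! ### Radial test functions with prescribed radial derivative. -/

/-- The primitive of `χ` that vanishes at `+∞`. -/
noncomputable def tailPrimitive (χ : ℝ → ℝ) (s : ℝ) : ℝ := - ∫ t in Ici s, χ t

/-- Fubini: integrating a radial primitive against a measure. -/
theorem integral_mul_tailPrimitive {ν : Measure (Euc n)} [IsFiniteMeasureOnCompacts ν]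
    {f : Euc n → ℝ} (hf : LocallyIntegrable f ν) {χ : ℝ → ℝ} (hχ : Continuous χ)
    (hc : HasCompactSupport χ) :
    ∫ x, f x * tailPrimitive χ ‖x‖ ∂ν
      = - ∫ t, χ t * ∫ x in Metric.closedBall (0 : Euc n) t, f x ∂ν := by
  obtain ⟨b, hb⟩ := hc.isCompact.bddAbove
  have hχb : ∀ t, b < t → χ t = 0 := fun t ht =>
    image_eq_zero_of_notMem_tsupport fun h => absurd (hb h) (not_le.2 ht)
  have hfb : Integrable ((Metric.closedBall (0 : Euc n) b).indicator f) ν :=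
    (hf.integrableOn_isCompact (isCompact_closedBall 0 b)).integrable_indicator
      Metric.isClosed_closedBall.measurableSet
  -- The condition `‖x‖ ≤ t` is closed on both sides: `Ici` in `tailPrimitive` matches closed balls.
  -- This matters when `ν` charges spheres.
  have hS : MeasurableSet {p : Euc n × ℝ | ‖p.1‖ ≤ p.2} :=
    (isClosed_le (by fun_prop) (by fun_prop)).measurableSet
  have hi := (hfb.mul_prod (hχ.integrable_of_hasCompactSupport (μ := volume) hc)).indicator hS
  -- The truncation of `f` to radius `b` is harmless: for `t ≤ b` it is implied by `‖x‖ ≤ t`, and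
  -- for `t > b` one has `χ t = 0`.
  have he : {p : Euc n × ℝ | ‖p.1‖ ≤ p.2}.indicator
      (fun z : Euc n × ℝ => (Metric.closedBall (0 : Euc n) b).indicator f z.1 * χ z.2)
      = fun z => {p : Euc n × ℝ | ‖p.1‖ ≤ p.2}.indicator (fun z => f z.1 * χ z.2) z := by
    ext ⟨x, t⟩
    by_cases h1 : ‖x‖ ≤ t
    · rcases le_or_gt t b with h2 | h2
      · simp [indicator, h1, h1.trans h2]
      · simp [indicator, hχb t h2]
    · simp [indicator, h1]
  rw [he] at hi
  have h1 : ∀ x, f x * tailPrimitive χ ‖x‖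
      = - ∫ t, {p : Euc n × ℝ | ‖p.1‖ ≤ p.2}.indicator (fun z => f z.1 * χ z.2) (x, t) := fun x => by
    rw [tailPrimitive, mul_neg, ← integral_const_mul, ← integral_indicator measurableSet_Ici]
    rfl
  have h2 : ∀ t, χ t * ∫ x in Metric.closedBall (0 : Euc n) t, f x ∂ν
      = ∫ x, {p : Euc n × ℝ | ‖p.1‖ ≤ p.2}.indicator (fun z => f z.1 * χ z.2) (x, t) ∂ν := fun t => by
    rw [← integral_const_mul, ← integral_indicator Metric.isClosed_closedBall.measurableSet]
    congr 1
    ext x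
    by_cases h : ‖x‖ ≤ t <;> simp [indicator, h, mul_comm]
  simp only [h1, h2]
  rw [integral_neg, integral_integral_swap (f := fun x t =>
    {p : Euc n × ℝ | ‖p.1‖ ≤ p.2}.indicator (fun z => f z.1 * χ z.2) (x, t)) hi]

section Primitive

variable {χ : ℝ → ℝ}

theorem exists_tailPrimitive_eq (hχ : Continuous χ) (hc : HasCompactSupport χ) :
    ∃ b, (∀ s, tailPrimitive χ s = ∫ t in b..s, χ t) ∧ ∀ s, b ≤ s → tailPrimitive χ s = 0 := by
  obtain ⟨b, hb⟩ := hc.isCompact.bddAbove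
  have hχb : ∀ t, b < t → χ t = 0 := fun t ht =>
    image_eq_zero_of_notMem_tsupport fun h => absurd (hb h) (not_le.2 ht)
  have hint := hχ.integrable_of_hasCompactSupport (μ := volume) hc
  have h0 : ∫ t in Ioi b, χ t = 0 := by
    rw [setIntegral_congr_fun (g := fun _ => (0 : ℝ)) measurableSet_Ioi fun t ht => hχb t ht]
    simp
  have h1 : ∀ s, tailPrimitive χ s = ∫ t in b..s, χ t := fun s => by
    have := intervalIntegral.integral_Ioi_sub_Ioi' (hint.integrableOn (s := Ioi b))
      (hint.integrableOn (s := Ioi s))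
    rw [tailPrimitive, integral_Ici_eq_integral_Ioi]
    linarith
  refine ⟨b, h1, fun s hs => ?_⟩
  rw [tailPrimitive, integral_Ici_eq_integral_Ioi, neg_eq_zero,
    setIntegral_congr_fun (g := fun _ => (0 : ℝ)) measurableSet_Ioi
      fun t ht => hχb t (lt_of_le_of_lt hs ht)]
  simp

theorem hasDerivAt_tailPrimitive (hχ : Continuous χ) (hc : HasCompactSupport χ) (s : ℝ) :
    HasDerivAt (tailPrimitive χ) (χ s) s := by
  obtain ⟨b, hb, -⟩ := exists_tailPrimitive_eq hχ hc
  rw [funext hb]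
  exact intervalIntegral.integral_hasDerivAt_right (hχ.intervalIntegrable _ _)
    (hχ.stronglyMeasurableAtFilter _ _) hχ.continuousAt

theorem contDiff_tailPrimitive (hχ : ContDiff ℝ ∞ χ) (hc : HasCompactSupport χ) :
    ContDiff ℝ ∞ (tailPrimitive χ) := by
  have h := hasDerivAt_tailPrimitive hχ.continuous hc
  rw [contDiff_infty_iff_deriv]
  refine ⟨fun s => (h s).differentiableAt, ?_⟩
  rwa [funext fun s => (h s).deriv]

/-- `χ` vanishes near `0`, so the radial function is flat at the only point where the norm is not
smooth. -/
theorem tailPrimitive_eventually_const (hχ : Continuous χ) (hc : HasCompactSupport χ)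
    (h0 : (0 : ℝ) ∉ tsupport χ) :
    ∀ᶠ x : Euc n in nhds 0, tailPrimitive χ ‖x‖ = tailPrimitive χ 0 := by
  obtain ⟨b, hb, -⟩ := exists_tailPrimitive_eq hχ hc
  obtain ⟨ε, hε, hsub⟩ := Metric.isOpen_iff.1 (isClosed_tsupport χ).isOpen_compl 0 h0
  filter_upwards [Metric.ball_mem_nhds (0 : Euc n) hε] with x hx
  rw [hb, hb, ← intervalIntegral.integral_add_adjacent_intervals (b := 0)
    (hχ.intervalIntegrable _ _) (hχ.intervalIntegrable _ _), add_eq_left]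
  rw [intervalIntegral.integral_congr (g := fun _ => (0 : ℝ)) fun t ht => ?_]
  · simp
  · rw [uIcc_of_le (norm_nonneg x)] at ht
    refine image_eq_zero_of_notMem_tsupport (hsub ?_)
    rw [mem_ball_zero_iff] at hx ⊢
    rw [Real.norm_of_nonneg ht.1]
    exact ht.2.trans_lt hx

theorem isTest_tailPrimitive_norm (hχ : ContDiff ℝ ∞ χ) (hc : HasCompactSupport χ)
    (h0 : (0 : ℝ) ∉ tsupport χ) : IsTest (fun x : Euc n => tailPrimitive χ ‖x‖) := by
  constructor
  · refine contDiff_iff_contDiffAt.2 fun x => ?_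
    by_cases hx : x = 0
    · rw [hx]
      exact contDiffAt_const.congr_of_eventuallyEq
        (tailPrimitive_eventually_const hχ.continuous hc h0)
    · exact (contDiff_tailPrimitive hχ hc).contDiffAt.comp x (contDiffAt_norm ℝ hx)
  · obtain ⟨b, -, hb⟩ := exists_tailPrimitive_eq hχ.continuous hc
    refine HasCompactSupport.of_support_subset_isCompact (isCompact_closedBall (0 : Euc n) b)
      fun x hx => ?_
    by_contra h
    exact hx (hb _ (by simpa using (not_le.1 (by simpa using h)).le))

theorem fderiv_tailPrimitive_norm (hχ : ContDiff ℝ ∞ χ) (hc : HasCompactSupport χ)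
    (h0 : (0 : ℝ) ∉ tsupport χ) (x v : Euc n) :
    fderiv ℝ (fun x : Euc n => tailPrimitive χ ‖x‖) x v = χ ‖x‖ * (⟪x, v⟫ / ‖x‖) := by
  by_cases hx : x = 0
  · have h := tailPrimitive_eventually_const (n := n) hχ.continuous hc h0
    rw [hx, Filter.EventuallyEq.fderiv_eq (f := fun _ => tailPrimitive χ 0) h]
    simp
  · have h1 : HasFDerivAt (fun x : Euc n => ‖x‖) (‖x‖⁻¹ • innerSL ℝ x) x := by
      have h2 := ((hasStrictFDerivAt_norm_sq x).hasFDerivAt).sqrt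
        (by simpa using hx)
      simp only [Real.sqrt_sq (norm_nonneg _)] at h2
      refine h2.congr_fderiv ?_
      ext w
      simp
      field_simp
    have h2 : HasFDerivAt (fun x : Euc n => tailPrimitive χ ‖x‖) _ x :=
      (hasDerivAt_tailPrimitive hχ.continuous hc ‖x‖).comp_hasFDerivAt x h1
    rw [h2.fderiv]
    simp [div_eq_inv_mul]

end Primitive

end Radial

/-! ### Identities on spheres from radial test functions. -/

section TestFunctions

variable {n : ℕ}

theorem sum_smul_basisVec (x : Euc n) : ∑ i, x i • basisVec i = x := by
  simpa [basisVec] using (EuclideanSpace.basisFun (Fin n) ℝ).sum_repr x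

theorem sum_mul_clm_basisVec (L : Euc n →L[ℝ] ℝ) (x : Euc n) :
    ∑ i, x i * L (basisVec i) = L x := by
  conv_rhs => rw [← sum_smul_basisVec x, map_sum]
  simp

theorem inner_basisVec (x : Euc n) (i : Fin n) : ⟪x, basisVec i⟫ = x i := by
  simp [basisVec, EuclideanSpace.inner_single_right]

theorem hasCompactSupport_comp_norm {k : ℝ → ℝ} (hc : HasCompactSupport k) :
    HasCompactSupport (fun x : Euc n => k ‖x‖) := by
  obtain ⟨b, hb⟩ := hc.isCompact.bddAbove
  refine HasCompactSupport.of_support_subset_isCompact (isCompact_closedBall (0 : Euc n) b)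
    fun x hx => ?_
  simpa using hb (subset_tsupport k hx)

theorem integral_radial_mul_of_continuous [NeZero n] {k : ℝ → ℝ} (hk : Continuous k)
    (hc : HasCompactSupport k) {f : Euc n → ℝ} (hf : LocallyIntegrable f volume) :
    Integrable (fun x => k ‖x‖ * f x) ∧
      ∫ x, k ‖x‖ * f x = ∫ s, k s * sphericalDensity f s := by
  have h : Integrable (fun x => k ‖x‖ * f x) :=
    hf.integrable_smul_left_of_hasCompactSupport (hk.comp continuous_norm)
      (hasCompactSupport_comp_norm hc)
  exact ⟨h, integral_radial_mul h⟩

theorem continuous_div_id {χ : ℝ → ℝ} (hχ : Continuous χ) (h0 : (0 : ℝ) ∉ tsupport χ) :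
    Continuous (fun t => χ t / t) := by
  refine continuous_iff_continuousAt.2 fun t => ?_
  by_cases ht : t = 0
  · have : (fun t => χ t / t) =ᶠ[nhds t] fun _ => 0 := by
      rw [ht]
      filter_upwards [notMem_tsupport_iff_eventuallyEq.1 h0] with s hs
      simp [hs]
    exact continuousAt_const.congr this.symm
  · exact hχ.continuousAt.div continuousAt_id ht

theorem hasCompactSupport_div_id {χ : ℝ → ℝ} (hc : HasCompactSupport χ) :
    HasCompactSupport (fun t => χ t / t) := by
  simpa only [div_eq_mul_inv] using! hc.mul_right (f' := fun t => t⁻¹)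

theorem laplacian_apply {φ : Euc n → ℝ} (hφ : ContDiff ℝ ∞ φ) (x : Euc n) :
    (Δ φ) x = ∑ i, fderiv ℝ (fun y => fderiv ℝ φ y (basisVec i)) x (basisVec i) := by
  rw [InnerProductSpace.laplacian_eq_iteratedFDeriv_orthonormalBasis φ
    (EuclideanSpace.basisFun (Fin n) ℝ)]
  refine Finset.sum_congr rfl fun i _ => ?_
  have hd : DifferentiableAt ℝ (fderiv ℝ φ) x :=
    (hφ.fderiv_right (m := ∞) (by simp)).differentiable (by simp) x
  rw [iteratedFDeriv_two_apply, fderiv_clm_apply hd (differentiableAt_const _)]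
  simp [basisVec]

/-- Testing a weakly differentiable function against a Laplacian. -/
theorem IsWeakGrad.integral_mul_laplacian {f : Euc n → ℝ} {G : Euc n → (Euc n →L[ℝ] ℝ)}
    (h : IsWeakGrad f G) {φ : Euc n → ℝ} (hφ : IsTest φ) :
    Integrable (fun x => f x * (Δ φ) x) ∧
      ∫ x, f x * (Δ φ) x
        = - ∫ x, ∑ i, fderiv ℝ φ x (basisVec i) * G x (basisVec i) := by
  have hi : ∀ i : Fin n, Integrable (fun x =>
      fderiv ℝ (fun y => fderiv ℝ φ y (basisVec i)) x (basisVec i) * f x) := fun i =>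
    ((hφ.fderiv_apply (basisVec i)).fderiv_apply (basisVec i)).integrable_smul h.1
  have hj : ∀ i : Fin n, Integrable (fun x =>
      fderiv ℝ φ x (basisVec i) * G x (basisVec i)) := fun i =>
    (hφ.fderiv_apply (basisVec i)).integrable_smul
      (locallyIntegrable_clm_apply h.2.1 continuous_const)
  have e : ∀ x, f x * (Δ φ) x
      = ∑ i, fderiv ℝ (fun y => fderiv ℝ φ y (basisVec i)) x (basisVec i) * f x := fun x => by
    rw [laplacian_apply hφ.1, ← Finset.sum_mul, mul_comm]
  simp only [e]
  refine ⟨integrable_finsetSum _ fun i _ => hi i, ?_⟩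
  rw [integral_finsetSum _ fun i _ => hi i, integral_finsetSum _ fun i _ => hj i,
    ← Finset.sum_neg_distrib]
  exact Finset.sum_congr rfl fun i _ => h.2.2 _ (hφ.fderiv_apply (basisVec i)) (basisVec i)

/-- The divergence theorem on balls for the field `f x`, for a weakly differentiable `f`. -/
theorem IsWeakGrad.ae_mul_sphericalDensity [NeZero n] {f : Euc n → ℝ}
    {G : Euc n → (Euc n →L[ℝ] ℝ)} (h : IsWeakGrad f G) :
    ∀ᵐ t, t ∈ Ioi (0 : ℝ) → t * sphericalDensity f t
      = n * (∫ x in Metric.closedBall (0 : Euc n) t, f x)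
        + ∫ x in Metric.closedBall (0 : Euc n) t, G x x := by
  have hg : LocallyIntegrable (fun x => G x x) volume :=
    locallyIntegrable_clm_apply h.2.1 continuous_id
  have hsd := locallyIntegrable_sphericalDensity h.1
  have c1 := continuous_setIntegral_closedBall h.1
  have c2 := continuous_setIntegral_closedBall hg
  have hloc1 : LocallyIntegrable (fun t => t * sphericalDensity f t) volume :=
    locallyIntegrableOn_univ.1 ((hsd.locallyIntegrableOn univ).continuousOn_smul
      isOpen_univ.isLocallyClosed continuous_id.continuousOn)
  have hloc2 : LocallyIntegrable (fun t => n * (∫ x in Metric.closedBall (0 : Euc n) t, f x)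
        + ∫ x in Metric.closedBall (0 : Euc n) t, G x x) volume :=
    ((continuous_const.mul c1).add c2).locallyIntegrable
  -- An almost everywhere identity on `(0, ∞)` is verified against `χ` supported there;
  -- `tailPrimitive χ ‖x‖` is then admissible in space.
  have key := isOpen_Ioi.ae_eq_zero_of_integral_contDiff_smul_eq_zero
    ((hloc1.sub hloc2).locallyIntegrableOn (Ioi 0)) (fun χ hχ hc hsub => ?_)
  · filter_upwards [key] with t ht h0
    exact sub_eq_zero.1 (ht h0)
  have h0 : (0 : ℝ) ∉ tsupport χ := fun h => lt_irrefl (0 : ℝ) (hsub h)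
  have hη := isTest_tailPrimitive_norm (n := n) hχ hc h0
  have hd := fderiv_tailPrimitive_norm (n := n) hχ hc h0
  have i1 : Integrable (fun t => χ t * (t * sphericalDensity f t)) :=
    hloc1.integrable_smul_left_of_hasCompactSupport hχ.continuous hc
  have i2 : Integrable (fun t => χ t * (n * (∫ x in Metric.closedBall (0 : Euc n) t, f x)
        + ∫ x in Metric.closedBall (0 : Euc n) t, G x x)) :=
    hloc2.integrable_smul_left_of_hasCompactSupport hχ.continuous hc
  have i3 : Integrable (fun t => χ t * (∫ x in Metric.closedBall (0 : Euc n) t, f x)) :=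
    c1.locallyIntegrable.integrable_smul_left_of_hasCompactSupport hχ.continuous hc
  have i4 : Integrable (fun t => χ t * (∫ x in Metric.closedBall (0 : Euc n) t, G x x)) :=
    c2.locallyIntegrable.integrable_smul_left_of_hasCompactSupport hχ.continuous hc
  simp only [Pi.sub_apply, smul_eq_mul, mul_sub]
  rw [integral_sub i1 i2]
  have e2 : ∫ t, χ t * (n * (∫ x in Metric.closedBall (0 : Euc n) t, f x)
        + ∫ x in Metric.closedBall (0 : Euc n) t, G x x)
      = n * (∫ t, χ t * (∫ x in Metric.closedBall (0 : Euc n) t, f x))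
        + ∫ t, χ t * (∫ x in Metric.closedBall (0 : Euc n) t, G x x) := by
    rw [← integral_const_mul, ← integral_add (i3.const_mul _) i4]
    congr 1
    ext t
    ring
  rw [e2]
  have f1 := integral_mul_tailPrimitive h.1 hχ.continuous hc
  have f2 := integral_mul_tailPrimitive hg hχ.continuous hc
  have hk : Continuous (fun t => χ t * t) := hχ.continuous.mul continuous_id
  obtain ⟨j1, j2⟩ := integral_radial_mul_of_continuous hk hc.mul_right h.1
  simp only [mul_assoc] at j2
  rw [← j2]
  have hcoord : ∀ i : Fin n, ContDiff ℝ ∞ (fun x : Euc n => x i) := fun i => by fun_prop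
  -- Testing in direction `i` with `η(|x|) xᵢ` and summing produces `div (η(|x|) x) = n η + |x|
  -- χ(|x|)` against `f`.
  have hw : ∀ i : Fin n, ∫ x, (tailPrimitive χ ‖x‖ + χ ‖x‖ * (x i / ‖x‖) * x i) * f x
      = - ∫ x, tailPrimitive χ ‖x‖ * (x i * G x (basisVec i)) := fun i => by
    have ht : IsTest (fun x : Euc n => tailPrimitive χ ‖x‖ * x i) := hη.smul_left (hcoord i)
    have h1 := h.2.2 _ ht (basisVec i)
    have h2 : ∀ x : Euc n, fderiv ℝ (fun x : Euc n => tailPrimitive χ ‖x‖ * x i) x (basisVec i)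
        = tailPrimitive χ ‖x‖ + χ ‖x‖ * (x i / ‖x‖) * x i := fun x => by
      rw [fderiv_fun_mul (hη.differentiable x) ((hcoord i).differentiable (by simp) x)]
      have h3 : fderiv ℝ (fun x : Euc n => x i) x = EuclideanSpace.proj i :=
        (EuclideanSpace.proj (𝕜 := ℝ) i : Euc n →L[ℝ] ℝ).hasFDerivAt.fderiv
      simp only [add_apply, smul_apply, hd, h3, inner_basisVec, smul_eq_mul]
      simp [basisVec]
      ring
    simp only [h2, smul_eq_mul, mul_assoc] at h1 ⊢
    exact h1
  have k1 : ∀ i : Fin n, Integrable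
      (fun x => (tailPrimitive χ ‖x‖ + χ ‖x‖ * (x i / ‖x‖) * x i) * f x) := fun i => by
    have hc' : Continuous (fun x : Euc n => χ ‖x‖ / ‖x‖) :=
      (continuous_div_id hχ.continuous h0).comp continuous_norm
    have := (hη.integrable_smul h.1).add (h.1.integrable_smul_left_of_hasCompactSupport
      ((hc'.mul (hcoord i).continuous).mul (hcoord i).continuous)
      ((hasCompactSupport_comp_norm (hasCompactSupport_div_id hc)).mul_right).mul_right)
    refine this.congr (Filter.Eventually.of_forall fun x => ?_)
    simp only [Pi.add_apply, Pi.mul_apply, smul_eq_mul]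
    ring
  have k2 : ∀ i : Fin n, Integrable
      (fun x => tailPrimitive χ ‖x‖ * (x i * G x (basisVec i))) := fun i => by
    have := (hη.smul_left (hcoord i)).integrable_smul
      (locallyIntegrable_clm_apply h.2.1 (continuous_const (y := basisVec i)))
    simpa only [smul_eq_mul, mul_assoc] using this
  have hsum := Finset.sum_congr (rfl : Finset.univ = (Finset.univ : Finset (Fin n)))
    fun i _ => hw i
  rw [Finset.sum_neg_distrib, ← integral_finsetSum _ fun i _ => k1 i,
    ← integral_finsetSum _ fun i _ => k2 i] at hsum
  have s1 : ∀ x, ∑ i, (tailPrimitive χ ‖x‖ + χ ‖x‖ * (x i / ‖x‖) * x i) * f x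
      = n * (f x * tailPrimitive χ ‖x‖) + χ ‖x‖ * (‖x‖ * f x) := fun x => by
    have hn : ∑ i, x i ^ 2 = ‖x‖ ^ 2 := by simp [EuclideanSpace.norm_sq_eq]
    rw [← Finset.sum_mul, Finset.sum_add_distrib]
    have : ∀ i, χ ‖x‖ * (x i / ‖x‖) * x i = χ ‖x‖ / ‖x‖ * x i ^ 2 := fun i => by ring
    simp only [this, ← Finset.mul_sum, hn, Finset.sum_const, Finset.card_univ, Fintype.card_fin,
      nsmul_eq_mul]
    by_cases hx : ‖x‖ = 0
    · simp [hx]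
      ring
    · field_simp
  have s2 : ∀ x, ∑ i, tailPrimitive χ ‖x‖ * (x i * G x (basisVec i))
      = G x x * tailPrimitive χ ‖x‖ := fun x => by
    rw [← Finset.mul_sum, sum_mul_clm_basisVec, mul_comm]
  simp only [s1, s2] at hsum
  simp only [mul_assoc] at j1
  have i5 : Integrable (fun x => n * (f x * tailPrimitive χ ‖x‖)) := by
    have := (hη.integrable_smul h.1).const_mul (n : ℝ)
    simpa only [smul_eq_mul, mul_comm (f _)] using this
  rw [integral_add i5 j1, integral_const_mul, f1, f2] at hsum
  linarith

end TestFunctions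

/-! ### Energy balance on balls, and the functionals `A` and `D`. -/

theorem locallyIntegrable_frobSq {n : ℕ} {G : Euc n → (Euc n →L[ℝ] Euc n)}
    (h : ∀ K : Set (Euc n), IsCompact K → MemLp G 2 (volume.restrict K)) :
    LocallyIntegrable (fun x => frobSq (G x)) volume := by
  refine locallyIntegrable_iff.2 fun K hK => ?_
  simp only [frobSq, frobInner, real_inner_self_eq_norm_sq]
  exact integrable_finsetSum _ fun i _ =>
    (memLp_clm_apply (h K hK) (basisVec i)).integrable_norm_pow (by simp)

theorem frobSq_nonneg {n : ℕ} (L : Euc n →L[ℝ] Euc n) : 0 ≤ frobSq L := by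
  unfold frobSq frobInner
  exact Finset.sum_nonneg fun _ _ => real_inner_self_nonneg

/-- Since `x/|x|` has length at most one, the flux vector field dominates. -/
theorem locallyIntegrable_radialFlux {u : Euc 5 → Euc 5} {P : Euc 5 → ℝ}
    (hf : LocallyIntegrable (fun x => (‖u x‖ ^ 2 / 2 + P x) • u x) volume) :
    LocallyIntegrable (radialFlux u P) volume := by
  have e : radialFlux u P = fun x => ‖x‖⁻¹ * ⟪(‖u x‖ ^ 2 / 2 + P x) • u x, x⟫ := by
    ext x
    rw [radialFlux, real_inner_smul_left]
    ring
  rw [e]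
  refine locallyIntegrable_of_norm_le_mul (c := fun _ => 1) hf ?_ continuous_const fun x => ?_
  · exact (measurable_norm.inv.aestronglyMeasurable).mul
      (hf.aestronglyMeasurable.inner aestronglyMeasurable_id)
  · rw [norm_mul, norm_inv, norm_norm, one_mul]
    refine (mul_le_mul_of_nonneg_left (norm_inner_le_norm _ _) (by positivity)).trans ?_
    rw [mul_comm ‖_ • u x‖, ← mul_assoc]
    exact mul_le_of_le_one_left (norm_nonneg _) inv_mul_le_one

/-- The local energy equality integrated over balls. -/
theorem IsSuitableWeakSolution.ae_energy_balance {u : Euc 5 → Euc 5} {P : Euc 5 → ℝ}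
    (h : IsSuitableWeakSolution u P) :
    ∃ m : ℝ → ℝ, (∀ t, 0 ≤ m t) ∧ ∀ᵐ t, t ∈ Ioi (0 : ℝ) →
      sphericalDensity (fun x => weakGrad (fun y => ‖u y‖ ^ 2 / 2) x x) t / t
        - sphericalDensity (radialFlux u P) t
      = (∫ x in Metric.closedBall (0 : Euc 5) t, frobSq (weakGrad u x)) + m t := by
  obtain ⟨μ, hμ, hE⟩ := h.local_energy
  have hW : IsWeakGrad (fun y => ‖u y‖ ^ 2 / 2) (weakGrad fun y => ‖u y‖ ^ 2 / 2) :=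
    isWeakGrad_weakGrad ⟨_, h.sobolev.isWeakGrad_normSq_div_two⟩
  have hg : LocallyIntegrable (fun x => weakGrad (fun y => ‖u y‖ ^ 2 / 2) x x) volume :=
    locallyIntegrable_clm_apply hW.2.1 continuous_id
  have hfl := locallyIntegrable_radialFlux h.flux
  have hfr := locallyIntegrable_frobSq fun K hK => (h.sobolev.2 K hK).2
  have hone : LocallyIntegrable (fun _ : Euc 5 => (1 : ℝ)) μ := locallyIntegrable_const 1
  -- The defect is the mass `μ(B_t)`, written as an integral so that the Fubini lemma applies to `μ`
  -- too. It need not be continuous in `t`; monotonicity gives local integrability.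
  refine ⟨fun t => ∫ _ in Metric.closedBall (0 : Euc 5) t, (1 : ℝ) ∂μ,
    fun t => integral_nonneg fun _ => zero_le_one, ?_⟩
  have hm : LocallyIntegrable (fun t => ∫ _ in Metric.closedBall (0 : Euc 5) t, (1 : ℝ) ∂μ)
      volume := by
    refine Monotone.locallyIntegrable fun s t hst => ?_
    exact setIntegral_mono_set (hone.integrableOn_isCompact (isCompact_closedBall 0 t))
      (Filter.Eventually.of_forall fun _ => zero_le_one)
      (Metric.closedBall_subset_closedBall hst).eventuallyLE
  have cfr := (continuous_setIntegral_closedBall hfr).locallyIntegrable (μ := volume)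
  have l1 := ((locallyIntegrable_sphericalDensity hg).locallyIntegrableOn
    (Ioi 0)).continuousOn_smul isOpen_Ioi.isLocallyClosed
      (continuousOn_inv₀.mono fun t (ht : 0 < t) => ht.ne')
  have l2 := (locallyIntegrable_sphericalDensity hfl).locallyIntegrableOn (Ioi 0)
  have l3 := (locallyIntegrable_iff.2 fun K hK =>
    (cfr.integrableOn_isCompact hK).add (hm.integrableOn_isCompact hK)).locallyIntegrableOn
    (Ioi (0 : ℝ))
  have key := isOpen_Ioi.ae_eq_zero_of_integral_contDiff_smul_eq_zero
    ((l1.sub l2).sub l3) (fun χ hχ hc hsub => ?_)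
  · filter_upwards [key] with t ht h0
    have := ht h0
    simp only [Pi.sub_apply, smul_eq_mul, Pi.add_apply] at this
    rw [div_eq_inv_mul]
    exact sub_eq_zero.1 this
  have h0 : (0 : ℝ) ∉ tsupport χ := fun h => lt_irrefl (0 : ℝ) (hsub h)
  have hη := isTest_tailPrimitive_norm (n := 5) hχ hc h0
  have hd := fderiv_tailPrimitive_norm (n := 5) hχ hc h0
  have hEη := hE _ hη
  obtain ⟨a1, a2⟩ := hW.integral_mul_laplacian hη
  obtain ⟨b1, b2⟩ := integral_radial_mul_of_continuous (continuous_div_id hχ.continuous h0)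
    (hasCompactSupport_div_id hc) hg
  obtain ⟨c1, c2⟩ := integral_radial_mul_of_continuous hχ.continuous hc hfl
  have d1 : Integrable (fun x => frobSq (weakGrad u x) * tailPrimitive χ ‖x‖) := by
    simpa only [smul_eq_mul, mul_comm] using hη.integrable_smul hfr
  -- The gradient of the test function is `χ(|x|) x/|x|`, so the Laplacian term, after one
  -- integration by parts, only sees the radial derivative of `|u|²/2`.
  have s1 : ∀ x : Euc 5, ∑ i, fderiv ℝ (fun x : Euc 5 => tailPrimitive χ ‖x‖) x (basisVec i)
      * weakGrad (fun y => ‖u y‖ ^ 2 / 2) x (basisVec i)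
      = χ ‖x‖ / ‖x‖ * weakGrad (fun y => ‖u y‖ ^ 2 / 2) x x := fun x => by
    rw [← sum_mul_clm_basisVec _ x, Finset.mul_sum]
    refine Finset.sum_congr rfl fun i _ => ?_
    rw [hd, inner_basisVec]
    ring
  have s2 : ∀ x : Euc 5, (‖u x‖ ^ 2 / 2 + P x)
      * fderiv ℝ (fun x : Euc 5 => tailPrimitive χ ‖x‖) x (u x) = χ ‖x‖ * radialFlux u P x :=
    fun x => by
      rw [hd, radialFlux, real_inner_comm]
      ring
  simp only [s1] at a2
  simp only [s2] at hEη
  have ad : Integrable (fun x => ‖u x‖ ^ 2 / 2 * (Δ (fun y : Euc 5 => tailPrimitive χ ‖y‖)) x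
      - frobSq (weakGrad u x) * tailPrimitive χ ‖x‖) := a1.sub d1
  rw [integral_add ad c1, integral_sub a1 d1, a2,
    integral_mul_tailPrimitive hfr hχ.continuous hc] at hEη
  have f2 := integral_mul_tailPrimitive hone hχ.continuous hc
  simp only [one_mul] at f2
  rw [f2, b2, c2] at hEη
  have i1 : Integrable (fun t => χ t / t
      * sphericalDensity (fun x => weakGrad (fun y => ‖u y‖ ^ 2 / 2) x x) t) :=
    (locallyIntegrable_sphericalDensity hg).integrable_smul_left_of_hasCompactSupport
      (continuous_div_id hχ.continuous h0) (hasCompactSupport_div_id hc)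
  have i2 : Integrable (fun t => χ t * sphericalDensity (radialFlux u P) t) :=
    (locallyIntegrable_sphericalDensity hfl).integrable_smul_left_of_hasCompactSupport
      hχ.continuous hc
  have i3 : Integrable (fun t => χ t *
      ∫ x in Metric.closedBall (0 : Euc 5) t, frobSq (weakGrad u x)) :=
    cfr.integrable_smul_left_of_hasCompactSupport hχ.continuous hc
  have i4 : Integrable (fun t => χ t * ∫ _ in Metric.closedBall (0 : Euc 5) t, (1 : ℝ) ∂μ) :=
    hm.integrable_smul_left_of_hasCompactSupport hχ.continuous hc
  have e : ∀ t, χ t • (((fun t => t⁻¹ • sphericalDensity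
        (fun x => weakGrad (fun y => ‖u y‖ ^ 2 / 2) x x) t) - sphericalDensity (radialFlux u P))
        t - ((∫ x in Metric.closedBall (0 : Euc 5) t, frobSq (weakGrad u x))
        + ∫ _ in Metric.closedBall (0 : Euc 5) t, (1 : ℝ) ∂μ))
      = (χ t / t * sphericalDensity (fun x => weakGrad (fun y => ‖u y‖ ^ 2 / 2) x x) t
        - χ t * sphericalDensity (radialFlux u P) t)
        - (χ t * (∫ x in Metric.closedBall (0 : Euc 5) t, frobSq (weakGrad u x))
        + χ t * ∫ _ in Metric.closedBall (0 : Euc 5) t, (1 : ℝ) ∂μ) := fun t => by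
    simp only [Pi.sub_apply, smul_eq_mul]
    ring
  refine (integral_congr_ae (Filter.Eventually.of_forall e)).trans ?_
  have i12 : Integrable (fun t => χ t / t
      * sphericalDensity (fun x => weakGrad (fun y => ‖u y‖ ^ 2 / 2) x x) t
      - χ t * sphericalDensity (radialFlux u P) t) := i1.sub i2
  have i34 : Integrable (fun t => χ t *
      (∫ x in Metric.closedBall (0 : Euc 5) t, frobSq (weakGrad u x))
      + χ t * ∫ _ in Metric.closedBall (0 : Euc 5) t, (1 : ℝ) ∂μ) := i3.add i4
  rw [integral_sub i12 i34, integral_sub i1 i2, integral_add i3 i4]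
  linarith

/-- If the derivative of an absolutely continuous function dominates a continuous function almost
everywhere, then it does so at every point of differentiability. -/
theorem le_deriv_of_ae_le_deriv {f g : ℝ → ℝ}
    (hf : ∀ a b : ℝ, 0 < a → a ≤ b → AbsolutelyContinuousOnInterval f a b)
    (hg : ContinuousOn g (Ioi 0)) (h : ∀ᵐ t, t ∈ Ioi (0 : ℝ) → g t ≤ deriv f t)
    {r : ℝ} (hr : 0 < r) (hd : DifferentiableAt ℝ f r) : g r ≤ deriv f r := by
  have hgi : ∀ a b : ℝ, 0 < a → a ≤ b → IntervalIntegrable g volume a b := fun a b ha hab =>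
    (hg.mono fun t ht => ha.trans_le (by rw [uIcc_of_le hab] at ht; exact ht.1)).intervalIntegrable
  -- With `G` the primitive of `g` from `r`, absolute continuity makes the right difference
  -- quotients of `f - G` at `r` nonnegative; their limit is `f'(r) - g(r)`.
  have hG : HasDerivAt (fun t => ∫ s in r..t, g s) (g r) r :=
    intervalIntegral.integral_hasDerivAt_right (by simp)
      (hg.stronglyMeasurableAtFilter isOpen_Ioi r hr) (hg.continuousAt (Ioi_mem_nhds hr))
  have hdiff := (hd.hasDerivAt.sub hG).hasDerivWithinAt (s := Ioi r)
  have hnn := (hasDerivWithinAt_iff_tendsto_slope' (by simp)).1 hdiff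
  have := ge_of_tendsto hnn (b := 0) (by
    filter_upwards [self_mem_nhdsWithin] with t ht
    have hrt : r < t := ht
    rw [slope_def_field]
    refine div_nonneg ?_ (by linarith)
    have h1 := (hf r t hr hrt.le).integral_deriv_eq_sub
    have h2 : ∫ s in r..t, g s ≤ ∫ s in r..t, deriv f s := by
      refine intervalIntegral.integral_mono_ae_restrict hrt.le (hgi r t hr hrt.le)
        (hf r t hr hrt.le).intervalIntegrable_deriv ?_
      filter_upwards [ae_restrict_of_ae h, ae_restrict_mem measurableSet_Icc] with s hs hs'
      exact hs (hr.trans_le hs'.1)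
    simp only [Pi.sub_apply, intervalIntegral.integral_same]
    linarith)
  linarith

/-- The only weight of variable sign is `r² - |x|²`, which is nonnegative inside the ball. -/
theorem DDensity_nonneg (u : Euc 5 → Euc 5) {r : ℝ} (hr : 0 < r) {x : Euc 5} (hx : x ∈ B r) :
    0 ≤ DDensity u r x := by
  have hxr : ‖x‖ ≤ r := by simpa [B] using hx
  have h1 : 0 ≤ r ^ 2 - ‖x‖ ^ 2 := by nlinarith [norm_nonneg x]
  have h2 := frobSq_nonneg (weakGrad u x)
  have h3 := frobSq_nonneg (weakGrad (fun y => ‖y‖ • u y) x)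
  unfold DDensity
  positivity

theorem MemW12Loc.locallyIntegrable_normSq {n : ℕ} {u : Euc n → Euc n} (h : MemW12Loc u) :
    LocallyIntegrable (fun x => ‖u x‖ ^ 2) volume :=
  locallyIntegrable_iff.2 fun K hK => ((h.2 K hK).1.integrable_norm_pow (p := 2) (by simp) :)

theorem MemW12Loc.isWeakGrad_weakGrad_normSq_div_two {n : ℕ} {u : Euc n → Euc n}
    (h : MemW12Loc u) :
    IsWeakGrad (fun y => ‖u y‖ ^ 2 / 2) (weakGrad fun y => ‖u y‖ ^ 2 / 2) :=
  isWeakGrad_weakGrad ⟨_, h.isWeakGrad_normSq_div_two⟩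

theorem MemW12Loc.locallyIntegrable_radialDeriv {n : ℕ} {u : Euc n → Euc n} (h : MemW12Loc u) :
    LocallyIntegrable (fun x => weakGrad (fun y => ‖u y‖ ^ 2 / 2) x x) volume :=
  locallyIntegrable_clm_apply h.isWeakGrad_weakGrad_normSq_div_two.2.1 continuous_id

theorem isCompact_B (r : ℝ) : IsCompact (B r) := isCompact_closedBall 0 r

/-- Almost everywhere, the integrand of `D(r)` only involves `|u|²`, `|∇u|²` and `x · ∇|u|²/2`. -/
theorem MemW12Loc.DDensity_ae_eq {u : Euc 5 → Euc 5} (h : MemW12Loc u) {r : ℝ} (hr : 0 < r) :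
    DDensity u r =ᵐ[volume] fun x => 9 / (2 * r ^ 3) * ‖u x‖ ^ 2
      + 1 / r * frobSq (weakGrad u x)
      + 3 / (2 * r ^ 3) * weakGrad (fun y => ‖u y‖ ^ 2 / 2) x x := by
  -- The term `|x|²|∇u|²` in `|∇(|x|u)|²` cancels the `-|x|²` of the last weight, leaving `1/4 + 3/4
  -- = 1` for `|∇u|²` and `15/4 + 3/4 = 9/2` for `|u|²`.
  filter_upwards [h.frobSq_weakGrad_norm_smul] with x hx
  rw [DDensity, hx]
  field_simp
  ring

theorem MemW12Loc.integrableOn_DDensity {u : Euc 5 → Euc 5} (h : MemW12Loc u) {r : ℝ}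
    (hr : 0 < r) :
    IntegrableOn (DDensity u r) (B r) volume ∧
      D u r = 9 / (2 * r ^ 3) * (∫ x in B r, ‖u x‖ ^ 2)
        + 1 / r * (∫ x in B r, frobSq (weakGrad u x))
        + 3 / (2 * r ^ 3) * ∫ x in B r, weakGrad (fun y => ‖u y‖ ^ 2 / 2) x x := by
  have hae := ae_restrict_of_ae (s := B r) (h.DDensity_ae_eq hr)
  have i1 : Integrable (fun x => 9 / (2 * r ^ 3) * ‖u x‖ ^ 2) (volume.restrict (B r)) :=
    (h.locallyIntegrable_normSq.integrableOn_isCompact (isCompact_B r)).integrable.const_mul _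
  have i2 : Integrable (fun x => 1 / r * frobSq (weakGrad u x)) (volume.restrict (B r)) :=
    ((locallyIntegrable_frobSq fun K hK => (h.2 K hK).2).integrableOn_isCompact
      (isCompact_B r)).integrable.const_mul _
  have i3 : Integrable (fun x => 3 / (2 * r ^ 3) * weakGrad (fun y => ‖u y‖ ^ 2 / 2) x x)
      (volume.restrict (B r)) :=
    (h.locallyIntegrable_radialDeriv.integrableOn_isCompact
      (isCompact_B r)).integrable.const_mul _
  have i12 : Integrable (fun x => 9 / (2 * r ^ 3) * ‖u x‖ ^ 2
      + 1 / r * frobSq (weakGrad u x)) (volume.restrict (B r)) := i1.add i2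
  refine ⟨(i12.add i3).congr (Filter.EventuallyEq.symm hae), ?_⟩
  rw [D, integral_congr_ae hae, integral_add i12 i3, integral_add i1 i2, integral_const_mul,
    integral_const_mul, integral_const_mul]

theorem absolutelyContinuousOnInterval_mul_setIntegral {n : ℕ} [NeZero n] {f : Euc n → ℝ}
    (hf : LocallyIntegrable f volume) {c : ℝ → ℝ} (hc : ContDiffOn ℝ 1 c (Ioi 0)) {a b : ℝ}
    (ha : 0 < a) (hab : a ≤ b) :
    AbsolutelyContinuousOnInterval
      (fun r => c r * ∫ x in Metric.closedBall (0 : Euc n) r, f x) a b := by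
  have h1 : AbsolutelyContinuousOnInterval c a b :=
    ContDiffOn.absolutelyContinuousOnInterval (hc.mono fun t ht => by
      rw [uIcc_of_le hab] at ht
      exact ha.trans_le ht.1)
  exact h1.mul (absolutelyContinuousOnInterval_setIntegral_closedBall hf ha.le hab)

theorem IsSuitableWeakSolution.absolutelyContinuousOnInterval_A {u : Euc 5 → Euc 5}
    {P : Euc 5 → ℝ} (h : IsSuitableWeakSolution u P) {a b : ℝ} (ha : 0 < a) (hab : a ≤ b) :
    AbsolutelyContinuousOnInterval (A u P) a b := by
  have hc : ∀ k : ℕ, ∀ α β : ℝ, β ≠ 0 → ContDiffOn ℝ 1 (fun r : ℝ => α / (β * r ^ k)) (Ioi 0) :=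
    fun k α β hβ => contDiffOn_const.div (by fun_prop) fun r hr =>
      mul_ne_zero hβ (pow_ne_zero _ (ne_of_gt hr))
  have h1 := absolutelyContinuousOnInterval_mul_setIntegral
    h.sobolev.locallyIntegrable_radialDeriv (hc 3 1 1 one_ne_zero) ha hab
  have h2 := absolutelyContinuousOnInterval_mul_setIntegral
    h.sobolev.locallyIntegrable_normSq (hc 3 9 4 (by norm_num)) ha hab
  have h3 := absolutelyContinuousOnInterval_mul_setIntegral
    (locallyIntegrable_radialFlux h.flux) (hc 2 1 1 one_ne_zero) ha hab
  simp only [one_mul] at h1 h3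
  exact (h1.add h2).sub h3

/-- The derivative of `A` at almost every radius. -/
theorem IsSuitableWeakSolution.ae_hasDerivAt_A {u : Euc 5 → Euc 5} {P : Euc 5 → ℝ}
    (h : IsSuitableWeakSolution u P) :
    ∀ᵐ t, t ∈ Ioi (0 : ℝ) → ∃ m, 0 ≤ m ∧ HasDerivAt (A u P)
      (1 / t * D u t + 2 / t ^ 3 * (∫ x in B t, radialFlux u P x) + m) t := by
  obtain ⟨m, hm0, hm⟩ := h.ae_energy_balance
  filter_upwards [hm,
    h.sobolev.isWeakGrad_weakGrad_normSq_div_two.ae_mul_sphericalDensity,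
    ae_hasDerivAt_setIntegral_closedBall h.sobolev.locallyIntegrable_radialDeriv,
    ae_hasDerivAt_setIntegral_closedBall h.sobolev.isWeakGrad_weakGrad_normSq_div_two.1,
    ae_hasDerivAt_setIntegral_closedBall (locallyIntegrable_radialFlux h.flux)]
    with t e1 e2 d1 d2 d3 ht
  have ht0 : 0 < t := ht
  have htne : t ≠ 0 := ht0.ne'
  -- The surplus is the defect mass of the energy balance, multiplied by the factor `1/t²` of the
  -- flux term in `A`.
  refine ⟨m t / t ^ 2, div_nonneg (hm0 t) (by positivity), ?_⟩
  have hw : ∀ s, ∫ x in Metric.closedBall (0 : Euc 5) s, ‖u x‖ ^ 2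
      = 2 * ∫ x in Metric.closedBall (0 : Euc 5) s, ‖u x‖ ^ 2 / 2 := fun s => by
    rw [integral_div]
    ring
  have c1 : HasDerivAt (fun r : ℝ => 1 / r ^ 3) (-3 / t ^ 4) t := by
    have := (hasDerivAt_pow 3 t).inv (by positivity)
    simp only [one_div]
    refine this.congr_deriv ?_
    field_simp
    norm_num
    ring
  have c2 : HasDerivAt (fun r : ℝ => 9 / (4 * r ^ 3)) (-27 / (4 * t ^ 4)) t := by
    have := c1.const_mul (9 / 4)
    refine (this.congr_deriv (by ring)).congr_of_eventuallyEq
      (Filter.Eventually.of_forall fun r => ?_)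
    ring
  have c3 : HasDerivAt (fun r : ℝ => 1 / r ^ 2) (-2 / t ^ 3) t := by
    have := (hasDerivAt_pow 2 t).inv (by positivity)
    simp only [one_div]
    refine this.congr_deriv ?_
    field_simp
    norm_num
    ring
  have hA : HasDerivAt (A u P) _ t :=
    ((c1.mul d1).add (c2.mul ((d2.const_mul 2).congr_of_eventuallyEq
      (Filter.Eventually.of_forall hw)))).sub (c3.mul d3)
  refine hA.congr_deriv ?_
  rw [(h.sobolev.integrableOn_DDensity ht0).2]
  have e1 := e1 ht
  have e2 := e2 ht
  rw [div_sub' htne, div_eq_iff htne] at e1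
  push_cast at e2
  unfold B
  rw [hw t]
  generalize sphericalDensity (fun x => weakGrad (fun y => ‖u y‖ ^ 2 / 2) x x) t = a at *
  generalize sphericalDensity (radialFlux u P) t = c at *
  generalize sphericalDensity (fun y => ‖u y‖ ^ 2 / 2) t = w at *
  generalize (∫ x in Metric.closedBall (0 : Euc 5) t, frobSq (weakGrad u x)) = I₁ at *
  generalize (∫ x in Metric.closedBall (0 : Euc 5) t, ‖u x‖ ^ 2 / 2) = I₂ at *
  generalize (∫ x in Metric.closedBall (0 : Euc 5) t,
    weakGrad (fun y => ‖u y‖ ^ 2 / 2) x x) = I₃ at *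
  generalize (∫ x in Metric.closedBall (0 : Euc 5) t, radialFlux u P x) = I₄ at *
  generalize m t = μ at *
  -- `ea` turns `a/t³ - c/t²` into `(I₁ + μ)/t²`; `ew` turns the boundary term `9w/(2t³)` into `(45
  -- I₂ + 9 I₃)/(2t⁴)`. Adding the derivatives of the prefactors leaves `9 I₂/t⁴` and `3 I₃/(2t⁴)`,
  -- exactly as in `D/t`.
  have ea : a = t * c + (I₁ + μ) * t := by linarith
  have ew : w = (5 * I₂ + I₃) / t := by rw [eq_div_iff htne]; linarith
  rw [ea, ew]
  field_simp
  ring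

/-- This continuity is what allows the almost everywhere bound on `A'` to be upgraded to each point
of differentiability. -/
theorem continuousOn_inv_mul_D_add {u : Euc 5 → Euc 5} {P : Euc 5 → ℝ}
    (h : IsSuitableWeakSolution u P) :
    ContinuousOn (fun t => 1 / t * D u t + 2 / t ^ 3 * ∫ x in B t, radialFlux u P x)
      (Ioi 0) := by
  have c1 : Continuous fun t => ∫ x in B t, ‖u x‖ ^ 2 :=
    continuous_setIntegral_closedBall h.sobolev.locallyIntegrable_normSq
  have c2 : Continuous fun t => ∫ x in B t, frobSq (weakGrad u x) :=
    continuous_setIntegral_closedBall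
      (locallyIntegrable_frobSq fun K hK => (h.sobolev.2 K hK).2)
  have c3 : Continuous fun t => ∫ x in B t, weakGrad (fun y => ‖u y‖ ^ 2 / 2) x x :=
    continuous_setIntegral_closedBall h.sobolev.locallyIntegrable_radialDeriv
  have c4 : Continuous fun t => ∫ x in B t, radialFlux u P x :=
    continuous_setIntegral_closedBall (locallyIntegrable_radialFlux h.flux)
  have hne : ∀ t ∈ Ioi (0 : ℝ), t ≠ 0 := fun t ht => ne_of_gt ht
  have hD : ContinuousOn (D u) (Ioi 0) := by
    refine ContinuousOn.congr ?_ fun t ht => (h.sobolev.integrableOn_DDensity ht).2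
    refine ((ContinuousOn.mul ?_ c1.continuousOn).add (ContinuousOn.mul ?_ c2.continuousOn)).add
      (ContinuousOn.mul ?_ c3.continuousOn)
    all_goals exact continuousOn_const.div (by fun_prop) fun t ht => by have := hne t ht; positivity
  refine (ContinuousOn.mul ?_ hD).add (ContinuousOn.mul ?_ c4.continuousOn)
  all_goals exact continuousOn_const.div (by fun_prop) fun t ht => by have := hne t ht; positivity

end StatNS

/-! ### The proposition. -/

theorem proposition3p2 (u : StatNS.Euc 5 → StatNS.Euc 5) (P : StatNS.Euc 5 → ℝ)
    (h : StatNS.IsSuitableWeakSolution u P) :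
    -- the weak gradients in `A` and `D` exist
    (∃ G, StatNS.IsWeakGrad (fun y => ‖u y‖ ^ 2 / 2) G) ∧
    StatNS.MemW12Loc (fun y => ‖y‖ • u y) ∧
    -- all integrals converge
    (∀ r : ℝ, 0 < r →
      IntegrableOn (StatNS.DDensity u r) (StatNS.B r) volume ∧
      IntegrableOn (fun x => StatNS.weakGrad (fun y => ‖u y‖ ^ 2 / 2) x x) (StatNS.B r) volume ∧
      IntegrableOn (fun x => ‖u x‖ ^ 2) (StatNS.B r) volume ∧
      IntegrableOn (StatNS.radialFlux u P) (StatNS.B r) volume) ∧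
    (∀ r : ℝ, 0 < r → 0 ≤ StatNS.D u r) ∧
    -- `A` is locally absolutely continuous and differentiable almost everywhere on `(0, ∞)`
    (∀ a b : ℝ, 0 < a → a ≤ b → AbsolutelyContinuousOnInterval (StatNS.A u P) a b) ∧
    (∀ᵐ r ∂(volume.restrict (Ioi (0 : ℝ))), DifferentiableAt ℝ (StatNS.A u P) r) ∧
    -- the differential inequality, at every point of differentiability
    (∀ r : ℝ, 0 < r → DifferentiableAt ℝ (StatNS.A u P) r →
      1 / r * StatNS.D u r + 2 / r ^ 3 * (∫ x in StatNS.B r, StatNS.radialFlux u P x)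
        ≤ deriv (StatNS.A u P) r) := by
  have hAC : ∀ a b : ℝ, 0 < a → a ≤ b → AbsolutelyContinuousOnInterval (StatNS.A u P) a b :=
    fun a b => h.absolutelyContinuousOnInterval_A
  have hder := h.ae_hasDerivAt_A
  refine ⟨⟨_, h.sobolev.isWeakGrad_normSq_div_two⟩, h.sobolev.norm_smul, fun r hr =>
    ⟨(h.sobolev.integrableOn_DDensity hr).1,
      h.sobolev.locallyIntegrable_radialDeriv.integrableOn_isCompact (StatNS.isCompact_B r),
      h.sobolev.locallyIntegrable_normSq.integrableOn_isCompact (StatNS.isCompact_B r),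
      (StatNS.locallyIntegrable_radialFlux h.flux).integrableOn_isCompact
        (StatNS.isCompact_B r)⟩,
    fun r hr => setIntegral_nonneg Metric.isClosed_closedBall.measurableSet
      fun x hx => StatNS.DDensity_nonneg u hr hx,
    hAC, ?_, fun r hr hd => ?_⟩
  · rw [ae_restrict_iff' measurableSet_Ioi]
    filter_upwards [hder] with t ht ht0
    obtain ⟨m, -, hm⟩ := ht ht0
    exact hm.differentiableAt
  · refine StatNS.le_deriv_of_ae_le_deriv hAC (StatNS.continuousOn_inv_mul_D_add h) ?_ hr hd
    filter_upwards [hder] with t ht ht0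
    obtain ⟨m, hm0, hm⟩ := ht ht0
    rw [hm.deriv]
    linarith
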